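/- **Terms.** Let $\mathcal F$ be a signature, $\mathcal X$ an infinite set of variables and $\mathcal N$ an infinite set of names. Equations $\ell=r$ and rewrite rules $\ell\to r$ are built from terms of $T(\mathcal F,\mathcal X)$; general terms are those of $T(\mathcal F,\mathcal X\cup\mathcal N)$, and substitutions act on variables only. A term is ground if it has no variables (names are allowed). For a set $E$ of equations, $=_E$ is the least congruence on terms containing all instances $\ell\sigma=r\sigma$ of $\ell=r\in E$. Write $s=^{>\varepsilon}_E t$ if $s,t$ are the same variable or name, or $s=f(s_1,\dots,s_n)$, $t=f(t_1,\dots,t_n)$ with $s_i=_Et_i$ for all $i$. For a set $R$ of rules, $t\to_R t'$ means $t=C[\ell\sigma]$, $t'=C[r\sigma]$ for some $\ell\to r\in R$, some one-hole context $C$ and some $\sigma$; $t\to_{R,E}t'$ means $t=C[s]$, $s=_E\ell\sigma$, $t'=C[r\sigma]$ for such $\ell\to r$, $C$, $\sigma$; $t\to_{R/E}t'$ means $t=_Es\to_Rt'$ for some $s$. A term is irreducible if it has no $\to_{R_\downarrow/E_\downarrow}$ step. $R^=$ is the set of rules $R$ read as equations. **Orders.** A reduction order $>$ is a well-founded strict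 order on terms that is closed under contexts and substitutions. It is an $E$-strong reduction order if moreover: $s=_Es'>t'=_Et$ implies $s>t$; any ground $s,t$ satisfy $s>t$, $t>s$ or $s=_Et$; and for every set $D$ of names and every map $\rho:\mathcal N\to\mathcal N$ that is injective on $D$ and satisfies $a>b\Leftrightarrow a\rho>b\rho$ for $a,b\in D$, all terms $s,t$ with names in $D$ satisfy $s>t\Leftrightarrow s\rho>t\rho$. It is compatible with $R$ if $\ell>r$ for all $\ell\to r\in R$. For ground $t$, $\min_E(t)$ denotes a ground term $m=_Et$ such that $m>s$ for no ground $s=_Et$. **Rewrite theories.** A tuple $T=(>,R,R_\downarrow,E_\downarrow,E_A)$ is a rewrite theory if $E_\downarrow\subseteq E_A$; $>$ is an $E_\downarrow$-strong reduction order compatible with $R_\downarrow$; for each $f\in\mathcal F$ of arity $n$, $R$ contains $f(x_1,\dots,x_n)\to f(x_1,\dots,x_n)$ for some distinct variables $x_1,\dots,x_n$; and $\mathrm{vars}(r)\subseteq\mathrm{vars}(\ell)$ for all $\ell\to r\in R$. A set $M$ of terms is in normal form (with respect to $T$ and $E$) if $E_A\subseteq E$, there is a smallest name $k$ for $>$,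 and there is an injective map $\sigma:\mathrm{vars}(M)\to\mathcal N$ such that every name $a$ in its image satisfies $a\ne k$ and $a>b$ for all names $b$ of $M$, and $t\sigma=_{E_\downarrow}\min_E(t\sigma)$ for all $t\in M$. $T$ mimics $E$ if 1. $E_A\subseteq E$, and $t\to_{R_\downarrow,E_\downarrow}t'$ implies $t=_Et'$; 2. $f(t_1,\dots,t_n)=_Et$ for every rule $f(t_1,\dots,t_n)\to t$ in $R$; 3. whenever $f(t_1,\dots,t_n)=_Et$ and $\{t_1,\dots,t_n,t\}$ is in normal form, there are a rule $f(s_1,\dots,s_n)\to s$ in $R$ and a substitution $\sigma$ with $t=_{E_A}s\sigma$ and $t_i=_{E_A}s_i\sigma$ for all $i$. **Overlaps.** Let $\rho_1=(\ell_1\to r_1)$ and $\rho_2=(\ell_2\to r_2)$ be rules, with $\rho_2$ renamed so that they share no variable, and let $p$ be a non-variable position of $r_1$. An overlap set of $\rho_2$ on $\rho_1$ at $p$ is $\{\ell_1\theta\to r_1\theta[r_2\theta]_p : \theta\in S\}$, where $S$ is a complete set of $E_\downarrow$-unifiers of $r_1|_p$ and $\ell_2$: each $\theta\in S$ is an $E_\downarrow$-unifier,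 and for each $E_\downarrow$-unifier $\gamma$ there are $\theta\in S$ and $\delta$ with $x\gamma=_{E_\downarrow}x\theta\delta$ for all variables $x$ of the two rules. (All substitutions here take values in $T(\mathcal F,\mathcal X)$.) **Normalisation.** A normalisation step replaces a set of rules in one of the following ways. * NormR: $R\cup\{\ell\to r\}$ by $R\cup\{\ell\to r'\}$, if $r\to_{R_\downarrow/E_\downarrow}r'$. * NormL: $R\cup\{f(\ell_1,\dots,\ell_n)\to r\}$ by $R\cup\{\ell'\to r,\ r\to\ell'\}$, where $\ell'$ is $f(\ell_1,\dots,\ell_n)$ with $\ell_j$ replaced by $\ell_j'$ and $\ell_j\to_{R_\downarrow/E_\downarrow}\ell_j'$. * Eq: $R\cup\{\ell\to r\}$ by $R$, if $\ell=_{E_\downarrow}r$. * Sub: $R\cup\{\ell\to r\}$ by $R$, if there are $\ell'\to r'\in R$, $C$ and $\sigma$ with $C[\ell'\sigma]=^{>\varepsilon}_{E_\downarrow}\ell$ and $C[r'\sigma]=_{E_\downarrow}r$, where $r'$ and all strict subterms of $\ell'$ are irreducible. **The procedure $\mathrm{GenExtended}(E',R_\downarrow,E_\downarrow)$.** Start with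 $R:=R_\downarrow\cup\{\ell\to r,\ r\to\ell : (\ell=r)\in E'\}$ and normalise $R$ by finitely many normalisation steps. Then repeat: let $R'$ consist of * for all $\rho_1=(\ell_1\to r_1),\rho_2\in R$ and all non-variable positions $p$ of $\ell_1$, the rules $u\to v$ and $v\to u$ for $u\to v$ in an overlap set of $\rho_2$ on $r_1\to\ell_1$ at $p$; * for all $\rho_1\in R\cup\{\ell\to r,\ r\to\ell : (\ell=r)\in E_\downarrow\}$, all $\rho_2\in R$ and all non-variable positions $p$ of the right-hand side of $\rho_1$, the rules of an overlap set of $\rho_2$ on $\rho_1$ at $p$; * the inverse $r\to\ell$ of each $\ell\to r\in R$; and replace $R$ by a set obtained from $R\cup R'$ by finitely many normalisation steps. The choices of renamings, of complete sets of unifiers and of normalisation steps are arbitrary. The procedure terminates when an iteration leaves $R$ unchanged; it then returns $R\cup\{f(x_1,\dots,x_n)\to f(x_1,\dots,x_n) : f\in\mathcal F\}$ with distinct variables $x_1,\dots,x_n$. **Theorem (correctness of GenExtended).** Let $E'$ and $E_\downarrow$ be sets of equations and $R_\downarrow$ a set of rewrite rules. Assume that all equivalence classes of $=_{E_\downarrow}$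 on terms are finite, that $>$ is an $E_\downarrow$-strong reduction order compatible with $R_\downarrow$, and that some execution of $\mathrm{GenExtended}(E',R_\downarrow,E_\downarrow)$ terminates and returns a set $R$ with $\mathrm{vars}(r)\subseteq\mathrm{vars}(\ell)$ for every $\ell\to r\in R$. Then $T=(>,R,R_\downarrow,E_\downarrow,E_\downarrow)$ is a rewrite theory that mimics $E=E'\cup R_\downarrow^=\cup E_\downarrow$. -/

import Mathlib

namespace RewTh

universe u v w w'

/-!
The symbols in `F` are the function symbols of a Mathlib first-order language `L` (relation
symbols play no role). `X` is the set of variables and `N` the set of names.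
`L.Term X` is the set of terms `T(F, X)`; equations and rewrite rules are built from it.
`L.Term (X ⊕ N)` is the set `T(F, X ∪ N)` of all terms.
-/

variable {L : FirstOrder.Language.{u, v}} {X : Type w} {N : Type w'}

/-- The set of variables occurring in a term. -/
def varSet {V : Type*} (t : L.Term V) : Set V :=
  letI := Classical.decEq V
  (t.varFinset : Set V)

/-- An oriented pair `(ℓ, r)`, read either as the equation `ℓ = r` or as the rule `ℓ → r`. -/
abbrev Rule (L : FirstOrder.Language.{u, v}) (X : Type w) := L.Term X × L.Term X

/-- The variables of a rule. -/
def ruleVars (ρ : Rule L X) : Set X := varSet ρ.1 ∪ varSet ρ.2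

/-! ### Contexts, equality modulo a theory, rewriting -/

/-- Contexts with exactly one hole. A position `p` of `t` is the same thing as a
decomposition `t = C[u]`, where `u` is the subterm of `t` at `p`. -/
inductive Ctx (L : FirstOrder.Language.{u, v}) (V : Type w) : Type (max u w)
  | hole : Ctx L V
  | func {n : ℕ} (f : L.Functions n) (i : Fin n) (ts : Fin n → L.Term V) (C : Ctx L V) : Ctx L V

namespace Ctx

/-- `C.fill s` is `C[s]` (the `i`-th entry of `ts` is overwritten). -/
def fill {V : Type w} : Ctx L V → L.Term V → L.Term V
  | hole, s => s
  | func f i ts C, s => FirstOrder.Language.Term.func f (Function.update ts i (C.fill s))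

/-- Application of a substitution to a context. -/
def subst {V : Type w} {V' : Type w'} : Ctx L V → (V → L.Term V') → Ctx L V'
  | hole, _ => hole
  | func f i ts C, θ => func f i (fun j => (ts j).subst θ) (C.subst θ)

end Ctx

/-- Equality modulo `E`: the least congruence that contains all instances of equations of `E`. -/
inductive EqMod (E : Set (Rule L X)) {V : Type*} : L.Term V → L.Term V → Prop
  | refl (t) : EqMod E t t
  | symm {s t} : EqMod E s t → EqMod E t s
  | trans {s t u} : EqMod E s t → EqMod E t u → EqMod E s u
  | inst {ρ : Rule L X} (h : ρ ∈ E) (σ : X → L.Term V) : EqMod E (ρ.1.subst σ) (ρ.2.subst σ)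
  | congr {n : ℕ} (f : L.Functions n) (ts us : Fin n → L.Term V) :
      (∀ i, EqMod E (ts i) (us i)) → EqMod E (FirstOrder.Language.Term.func f ts) (FirstOrder.Language.Term.func f us)

/-- Equality modulo `E` where equations are only applied strictly below the root. -/
inductive EqBelow (E : Set (Rule L X)) {V : Type*} : L.Term V → L.Term V → Prop
  | var (x : V) : EqBelow E (FirstOrder.Language.Term.var x) (FirstOrder.Language.Term.var x)
  | func {n : ℕ} (f : L.Functions n) (ts us : Fin n → L.Term V) :
      (∀ i, EqMod E (ts i) (us i)) → EqBelow E (FirstOrder.Language.Term.func f ts) (FirstOrder.Language.Term.func f us)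

/-- Syntactic rewriting `t →_R t'`. -/
def Rew (R : Set (Rule L X)) {V : Type*} (t t' : L.Term V) : Prop :=
  ∃ ρ ∈ R, ∃ (C : Ctx L V) (σ : X → L.Term V),
    t = C.fill (ρ.1.subst σ) ∧ t' = C.fill (ρ.2.subst σ)

/-- Rewriting `t →_{R,E} t'`: a subterm of `t` that is equal modulo `E` to an instance of a
left-hand side is replaced by the instance of the right-hand side. -/
def RewMod (R E : Set (Rule L X)) {V : Type*} (t t' : L.Term V) : Prop :=
  ∃ ρ ∈ R, ∃ (C : Ctx L V) (s : L.Term V) (σ : X → L.Term V),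
    t = C.fill s ∧ EqMod E s (ρ.1.subst σ) ∧ t' = C.fill (ρ.2.subst σ)

/-- Rewriting of equivalence classes: `t =_E s →_R t'` for some `s`. -/
def RewClass (R E : Set (Rule L X)) {V : Type*} (t t' : L.Term V) : Prop :=
  ∃ s, EqMod E t s ∧ Rew R s t'

/-- `t` cannot be rewritten by `R` modulo `E`. -/
def Irred (R E : Set (Rule L X)) {V : Type*} (t : L.Term V) : Prop :=
  ∀ t', ¬ RewClass R E t t'

/-! ### General terms: variables and names -/

/-- The variables of a general term. -/
def termVars (t : L.Term (X ⊕ N)) : Set X := {x | Sum.inl x ∈ varSet t}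

/-- The names of a general term. -/
def termNames (t : L.Term (X ⊕ N)) : Set N := {a | Sum.inr a ∈ varSet t}

/-- Ground terms: no variables (names are allowed). -/
def Ground (t : L.Term (X ⊕ N)) : Prop := termVars t = ∅

/-- A name, as a term. -/
def name (a : N) : L.Term (X ⊕ N) := FirstOrder.Language.Term.var (Sum.inr a)

/-- Application of a substitution of the variables; names are left unchanged. -/
def applySubst (t : L.Term (X ⊕ N)) (σ : X → L.Term (X ⊕ N)) : L.Term (X ⊕ N) :=
  t.subst (Sum.elim σ name)

/-- Application of a renaming of the names; variables are left unchanged. -/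
def applyRenaming (t : L.Term (X ⊕ N)) (ρ : N → N) : L.Term (X ⊕ N) :=
  t.relabel (Sum.map id ρ)

/-- All equivalence classes of `=_E` on terms are finite. -/
def FiniteClasses (N : Type w') (E : Set (Rule L X)) : Prop :=
  ∀ t : L.Term (X ⊕ N), {s | EqMod E t s}.Finite

/-! ### Orders -/

/-- A reduction order: a well-founded strict order closed under contexts and substitutions. -/
structure IsReductionOrder (gt : L.Term (X ⊕ N) → L.Term (X ⊕ N) → Prop) : Prop where
  irrefl : ∀ s, ¬ gt s s
  trans : ∀ s t u, gt s t → gt t u → gt s u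
  wf : WellFounded fun s t => gt t s
  ctx : ∀ (C : Ctx L (X ⊕ N)) s t, gt s t → gt (C.fill s) (C.fill t)
  subst : ∀ (σ : X → L.Term (X ⊕ N)) s t, gt s t → gt (applySubst s σ) (applySubst t σ)

/-- The renaming `ρ` with domain `D` (a set of names) preserves the order. -/
def RenamingPreserves (gt : L.Term (X ⊕ N) → L.Term (X ⊕ N) → Prop) (D : Set N) (ρ : N → N) :
    Prop :=
  Set.InjOn ρ D ∧ ∀ a ∈ D, ∀ b ∈ D, gt (name a) (name b) ↔ gt (name (ρ a)) (name (ρ b))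

/-- An `E`-strong reduction order: a reduction order that is `E`-compatible, total on ground terms
up to `=_E`, and stable by the renamings that preserve it. -/
structure IsStrongReductionOrder (gt : L.Term (X ⊕ N) → L.Term (X ⊕ N) → Prop)
    (E : Set (Rule L X)) : Prop extends IsReductionOrder gt where
  compat : ∀ s s' t' t, EqMod E s s' → gt s' t' → EqMod E t' t → gt s t
  total : ∀ s t, Ground s → Ground t → gt s t ∨ gt t s ∨ EqMod E s t
  stable : ∀ (D : Set N) (ρ : N → N), RenamingPreserves gt D ρ →
    ∀ s t, termNames s ⊆ D → termNames t ⊆ D →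
      (gt s t ↔ gt (applyRenaming s ρ) (applyRenaming t ρ))

/-- A term of `T(F, X)` seen as a term of `T(F, X ∪ N)`. -/
def embed (N : Type w') (t : L.Term X) : L.Term (X ⊕ N) := t.relabel Sum.inl

/-- The order is compatible with a rewrite system: `ℓ > r` for all its rules `ℓ → r`. -/
def CompatibleWith (gt : L.Term (X ⊕ N) → L.Term (X ⊕ N) → Prop) (R : Set (Rule L X)) : Prop :=
  ∀ ρ ∈ R, gt (embed N ρ.1) (embed N ρ.2)

/-- `m` is a minimal term, with respect to the order, of the set of the ground terms that are equal
to `t` modulo `E`. -/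
def IsMinOf (gt : L.Term (X ⊕ N) → L.Term (X ⊕ N) → Prop) (E : Set (Rule L X))
    (t m : L.Term (X ⊕ N)) : Prop :=
  Ground m ∧ EqMod E t m ∧ ∀ s, Ground s → EqMod E t s → ¬ gt m s

/-! ### Rewrite theories -/

/-- A tuple `(>, R, R↓, E↓, E_A)`. -/
structure Tuple (L : FirstOrder.Language.{u, v}) (X : Type w) (N : Type w') where
  gt : L.Term (X ⊕ N) → L.Term (X ⊕ N) → Prop
  R : Set (Rule L X)
  Rd : Set (Rule L X)
  Ed : Set (Rule L X)
  Ea : Set (Rule L X)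

/-- The tuple is a rewrite theory. -/
structure Tuple.IsRewriteTheory (T : Tuple L X N) : Prop where
  subset : T.Ed ⊆ T.Ea
  order : IsStrongReductionOrder T.gt T.Ed
  compatible : CompatibleWith T.gt T.Rd
  refl_rules : ∀ {n : ℕ} (f : L.Functions n), ∃ xs : Fin n → X, Function.Injective xs ∧
    (FirstOrder.Language.Term.func f fun i => FirstOrder.Language.Term.var (xs i),
      FirstOrder.Language.Term.func f fun i => FirstOrder.Language.Term.var (xs i)) ∈ T.R
  vars : ∀ ρ ∈ T.R, varSet ρ.2 ⊆ varSet ρ.1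

/-- The set of terms `M` is in normal form with respect to `T` and `E`. The injective
substitution `σ` maps the variables of `M` to names that differ from the smallest name `k` and
are greater than all names of `M`. -/
def Tuple.NormalForm (T : Tuple L X N) (E : Set (Rule L X)) (M : Set (L.Term (X ⊕ N))) : Prop :=
  T.Ea ⊆ E ∧
  ∃ k : N, (∀ b, b ≠ k → T.gt (name b) (name k)) ∧
  ∃ σ : X → N, Set.InjOn σ (⋃ t ∈ M, termVars t) ∧
    (∀ x ∈ ⋃ t ∈ M, termVars t, σ x ≠ k ∧
      ∀ b ∈ ⋃ t ∈ M, termNames t, T.gt (name (σ x)) (name b)) ∧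
    ∀ t ∈ M, ∃ m, IsMinOf T.gt E (applySubst t fun x => name (σ x)) m ∧
      EqMod T.Ed (applySubst t fun x => name (σ x)) m

/-- The tuple mimics the equational theory `E`. (The variables of a rule only occur under the
existentially quantified `σ`, so no renaming apart is needed.) -/
structure Tuple.Mimics (T : Tuple L X N) (E : Set (Rule L X)) : Prop where
  subset : T.Ea ⊆ E
  rewrite : ∀ t t' : L.Term (X ⊕ N), RewMod T.Rd T.Ed t t' → EqMod E t t'
  sound : ∀ {n : ℕ} (f : L.Functions n) (ts : Fin n → L.Term X) (t : L.Term X),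
    (FirstOrder.Language.Term.func f ts, t) ∈ T.R → EqMod E (FirstOrder.Language.Term.func f ts) t
  complete : ∀ {n : ℕ} (f : L.Functions n) (ts : Fin n → L.Term (X ⊕ N)) (t : L.Term (X ⊕ N)),
    EqMod E (FirstOrder.Language.Term.func f ts) t → T.NormalForm E (insert t (Set.range ts)) →
    ∃ (ss : Fin n → L.Term X) (s : L.Term X) (σ : X → L.Term (X ⊕ N)),
      (FirstOrder.Language.Term.func f ss, s) ∈ T.R ∧ EqMod T.Ea t (s.subst σ) ∧
      ∀ i, EqMod T.Ea (ts i) ((ss i).subst σ)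

/-! ### Overlaps -/

/-- `S` is a complete set of `E`-unifiers of `s` and `t` relative to the variables in `W`. -/
structure IsMguSet (E : Set (Rule L X)) (W : Set X) (s t : L.Term X)
    (S : Set (X → L.Term X)) : Prop where
  sound : ∀ θ ∈ S, EqMod E (s.subst θ) (t.subst θ)
  complete : ∀ γ : X → L.Term X, EqMod E (s.subst γ) (t.subst γ) →
    ∃ θ ∈ S, ∃ δ : X → L.Term X, ∀ x ∈ W, EqMod E (γ x) ((θ x).subst δ)

/-- Renaming of the variables of a rule. -/
def renameRule (ρ : Rule L X) (π : Equiv.Perm X) : Rule L X := (ρ.1.relabel π, ρ.2.relabel π)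

/-- `O` is a set of `E`-overlaps of the rule `ρ₂` on the rule `ρ₁`, at the position of the
right-hand side of `ρ₁` given by the decomposition `C[s]`: the variables of `ρ₂` are renamed apart,
and `O` consists of the rules `ℓ₁θ → r₁θ[r₂θ]_p` for the unifiers `θ` in a complete set of
`E`-unifiers of `s = r₁|_p` and `ℓ₂`. -/
def IsOverlapSet (E : Set (Rule L X)) (ρ₁ : Rule L X) (C : Ctx L X) (s : L.Term X)
    (ρ₂ : Rule L X) (O : Set (Rule L X)) : Prop :=
  ∃ π : Equiv.Perm X, Disjoint (ruleVars ρ₁) (ruleVars (renameRule ρ₂ π)) ∧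
  ∃ S, IsMguSet E (ruleVars ρ₁ ∪ ruleVars (renameRule ρ₂ π)) s (renameRule ρ₂ π).1 S ∧
    O = (fun θ => (ρ₁.1.subst θ, (C.subst θ).fill ((renameRule ρ₂ π).2.subst θ))) '' S

/-- `t = C[s]` where `s` is not a variable: a non-variable position of `t`. -/
def NonVarPos (t : L.Term X) (C : Ctx L X) (s : L.Term X) : Prop :=
  t = C.fill s ∧ ∀ x, s ≠ FirstOrder.Language.Term.var x

/-! ### Normalisation of sets of rules -/

/-- One normalisation step of sets of rules, with respect to `R↓` and `E↓`. -/
inductive NormStep (Rd Ed : Set (Rule L X)) : Set (Rule L X) → Set (Rule L X) → Prop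
  | normR (R : Set (Rule L X)) (l r r' : L.Term X) : RewClass Rd Ed r r' →
      NormStep Rd Ed (R ∪ {(l, r)}) (R ∪ {(l, r')})
  | normL (R : Set (Rule L X)) {n : ℕ} (f : L.Functions n) (ls : Fin n → L.Term X)
      (j : Fin n) (l' r : L.Term X) : RewClass Rd Ed (ls j) l' →
      NormStep Rd Ed (R ∪ {(FirstOrder.Language.Term.func f ls, r)})
        (R ∪ {(FirstOrder.Language.Term.func f (Function.update ls j l'), r),
          (r, FirstOrder.Language.Term.func f (Function.update ls j l'))})
  | eq (R : Set (Rule L X)) (l r : L.Term X) : EqMod Ed l r →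
      NormStep Rd Ed (R ∪ {(l, r)}) R
  | sub (R : Set (Rule L X)) (l r l' r' : L.Term X) (C : Ctx L X) (σ : X → L.Term X) :
      (l', r') ∈ R → EqBelow Ed (C.fill (l'.subst σ)) l → EqMod Ed (C.fill (r'.subst σ)) r →
      Irred Rd Ed r' → (∀ D s, D ≠ Ctx.hole → l' = D.fill s → Irred Rd Ed s) →
      NormStep Rd Ed (R ∪ {(l, r)}) R

/-- Finitely many normalisation steps. -/
def Norm (Rd Ed : Set (Rule L X)) : Set (Rule L X) → Set (Rule L X) → Prop :=
  Relation.ReflTransGen (NormStep Rd Ed)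

/-! ### The procedure -/

/-- The initial set of rules: `R↓`, and the equations of `E'` oriented in both directions. -/
def initialRules (E' Rd : Set (Rule L X)) : Set (Rule L X) :=
  Rd ∪ E' ∪ Prod.swap '' E'

/-- `R'` is a set of rules generated from `R` by one iteration of the loop. For all rules of `R` it
contains the overlaps of a rule `ℓ₂ → r₂` with the left-hand side of `ℓ₁ → r₁` (in both directions),
the overlaps of `ℓ₂ → r₂` with the right-hand side of `ℓ₁ → r₁`, where `ℓ₁ → r₁` may also be an
equation of `E↓` in either direction, and all the inverse rules. The function `ov` chooses the
overlap sets, that is, the renamings and the complete sets of unifiers. -/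
def IsGenerated (Ed R R' : Set (Rule L X)) : Prop :=
  ∃ ov : Rule L X → Ctx L X → L.Term X → Rule L X → Set (Rule L X),
    (∀ ρ₁ C s ρ₂, NonVarPos ρ₁.2 C s → IsOverlapSet Ed ρ₁ C s ρ₂ (ov ρ₁ C s ρ₂)) ∧
    R' = {ρ | ∃ ρ₁ ∈ R, ∃ ρ₂ ∈ R, ∃ C s, NonVarPos ρ₁.1 C s ∧
            (ρ ∈ ov ρ₁.swap C s ρ₂ ∨ ρ.swap ∈ ov ρ₁.swap C s ρ₂)} ∪
         {ρ | ∃ ρ₁ ∈ R ∪ Ed ∪ Prod.swap '' Ed, ∃ ρ₂ ∈ R, ∃ C s, NonVarPos ρ₁.2 C s ∧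
            ρ ∈ ov ρ₁ C s ρ₂} ∪
         Prod.swap '' R

/-- The possible values of the set of rules in the course of the procedure, at the beginning of an
iteration of the loop. -/
inductive Reachable (E' Rd Ed : Set (Rule L X)) : Set (Rule L X) → Prop
  | init {R : Set (Rule L X)} : Norm Rd Ed (initialRules E' Rd) R → Reachable E' Rd Ed R
  | loop {R R' R'' : Set (Rule L X)} : Reachable E' Rd Ed R → IsGenerated Ed R R' →
      Norm Rd Ed (R ∪ R') R'' → Reachable E' Rd Ed R''

/-- The rules `f(x₁, …, xₙ) → f(x₁, …, xₙ)`, where `xs n` are the variables used for arity `n`. -/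
def reflRules (L : FirstOrder.Language.{u, v}) {X : Type w} (xs : ∀ n : ℕ, Fin n → X) : Set (Rule L X) :=
  {ρ | ∃ (n : ℕ) (f : L.Functions n),
    ρ = (FirstOrder.Language.Term.func f fun i => FirstOrder.Language.Term.var (xs n i),
      FirstOrder.Language.Term.func f fun i => FirstOrder.Language.Term.var (xs n i))}

/-- Some execution of the procedure on input `(E', R↓, E↓)` terminates and returns `Rout`: it
reaches a set `R` that is left unchanged by an iteration of the loop, and then adds the
rules `f(x₁, …, xₙ) → f(x₁, …, xₙ)`. -/
def GenExtendedReturns (E' Rd Ed Rout : Set (Rule L X)) : Prop :=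
  ∃ R R', Reachable E' Rd Ed R ∧ IsGenerated Ed R R' ∧ Norm Rd Ed (R ∪ R') R ∧
    ∃ xs : ∀ n : ℕ, Fin n → X, (∀ n, Function.Injective (xs n)) ∧ Rout = R ∪ reflRules L xs

end RewTh

/-!
The procedure is a completion procedure, and the theorem is proved as the correctness of one: the
rules `R` of the fixpoint rewrite every ground term `f(t₁, …, tₙ)` that is not minimal in its class,
but whose arguments are, to a minimal term of its class in a single step at the root. The rewrite theory conditions
and the soundness of the rules are direct.

All terms are first made ground by the substitution of names for variables that comes with a normal
form; ground terms are represented as the terms over `N`. On them the order is total modulo `E↓`,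
and it contains the subterm relation because the classes are finite. A ground term is called
reducible if an equational proof with `R`, `R↓` and `E↓` that never exceeds it leads to a smaller
term. Irreducible terms include the minimal terms of the classes of `E`.

* Normalisation loses nothing (`Covered`, `Covered.of_norm`): an instance of a rule of `R ∪ R'`, or of
  an initial rule, has a proof with `R`, `R↓` and `E↓` that is bounded by its two sides. If the instance is
  decreasing and the immediate subterms of its left-hand side are irreducible, then NormL cannot have
  been applied to it, nor Sub below the root, so that an instance of the final `R` has the same
  left-hand side and a right-hand side that is not larger.
* Overlaps lift to ground instances (`IsOverlapSet.lift`).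
* `IsSaturated.reduced`: a reducible term `u` with irreducible immediate subterms is, modulo `E↓`
  below the root, an instance of the left-hand side of a rule of `R`, and the instance of the
  right-hand side is irreducible. The proof is by induction on `u`. A decreasing step exists on some term equal to `u` modulo `E↓`; it is brought back to `u`
  along the equations of `E↓` by overlaps of `R` on these equations. A least right-hand side is
  irreducible by the overlaps of `R` on the right-hand sides of `R`; here `vars(r) ⊆ vars(ℓ)` is used.
* `IsSaturated.unique`: irreducible terms reached from a term without exceeding it are equal modulo
  `E↓`. By induction on the term, all ways of decreasing it are connected by smaller terms, which
  follows from the overlaps of `R` on the left-hand sides of `R` and on the equations of `E↓`.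

Hence terms that are equal in `E` have the same normal forms (`IsSaturated.eqMod_of_isNormalForm`), so
the single step given by `IsSaturated.reduced` leads from `f(t₁, …, tₙ)` to `t` modulo `E↓`; if
`f(t₁, …, tₙ)` is irreducible, it equals `t` modulo `E↓`, and the rule `f(x₁, …, xₙ) → f(x₁, …, xₙ)`
applies. Rules `x → r` of `R` do not interfere: `x` occurs in `r`, as otherwise the inverse rule
`r → x` of `R'` would leave in `R` a rule with a new variable on the right
(`hasNewVar_of_normStep`).
-/

namespace RewTh

open FirstOrder.Language Relation

universe u v w w'

variable {L : FirstOrder.Language.{u, v}} {X : Type w} {V : Type w'}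

/-! ### Variables and substitutions -/

@[simp]
theorem varSet_var {V : Type*} (x : V) : varSet (L := L) (Term.var x) = {x} := by
  simp [varSet]

@[simp]
theorem varSet_func {V : Type*} {n : ℕ} (f : L.Functions n) (ts : Fin n → L.Term V) :
    varSet (Term.func f ts) = ⋃ i, varSet (ts i) := by
  ext x; simp [varSet]

theorem finite_varSet {V : Type*} (t : L.Term V) : (varSet t).Finite := by
  simp [varSet]

theorem varSet_subst {V W : Type*} (t : L.Term V) (σ : V → L.Term W) :
    varSet (t.subst σ) = ⋃ x ∈ varSet t, varSet (σ x) := by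
  induction t with
  | var x => simp [Term.subst]
  | func f ts ih =>
    ext y
    simp only [Term.subst, varSet_func, ih, Set.mem_iUnion, exists_prop]
    grind

theorem subst_congr {V W : Type*} {t : L.Term V} {σ τ : V → L.Term W}
    (h : ∀ x ∈ varSet t, σ x = τ x) : t.subst σ = t.subst τ := by
  induction t with
  | var x => exact h x (by simp)
  | func f ts ih =>
    simp only [Term.subst]
    congr 1
    ext1 i
    exact ih i fun x hx => h x (by simpa using ⟨i, hx⟩)

theorem subst_subst {V W U : Type*} (t : L.Term V) (σ : V → L.Term W) (τ : W → L.Term U) :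
    (t.subst σ).subst τ = t.subst fun x => (σ x).subst τ := by
  induction t with
  | var x => rfl
  | func f ts ih => simp only [Term.subst, ih]

theorem relabel_eq_subst {V W : Type*} (t : L.Term V) (g : V → W) :
    t.relabel g = t.subst fun x => Term.var (g x) := by
  induction t with
  | var x => rfl
  | func f ts ih => simp only [Term.subst, Term.relabel, ih]

theorem subst_var {V : Type*} (t : L.Term V) : t.subst Term.var = t := by
  induction t with
  | var x => rfl
  | func f ts ih => simp only [Term.subst, ih]

theorem subst_relabel {V W U : Type*} (t : L.Term V) (g : V → W) (τ : W → L.Term U) :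
    (t.relabel g).subst τ = t.subst fun x => τ (g x) := by
  rw [relabel_eq_subst, subst_subst]; rfl

theorem relabel_subst {V W U : Type*} (t : L.Term V) (σ : V → L.Term W) (g : W → U) :
    (t.subst σ).relabel g = t.subst fun x => (σ x).relabel g := by
  simp only [relabel_eq_subst, subst_subst]

theorem varSet_relabel {V W : Type*} (t : L.Term V) (g : V → W) :
    varSet (t.relabel g) = g '' varSet t := by
  rw [relabel_eq_subst, varSet_subst]; ext; simp [eq_comm]

theorem relabel_injective {V W : Type*} {g : V → W} (hg : Function.Injective g) :
    Function.Injective (Term.relabel (L := L) g) := by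
  intro s t h
  rcases isEmpty_or_nonempty V with hV | hV
  · have : g = fun x => (hV.elim x) := funext fun x => hV.elim x
    induction s generalizing t with
    | var x => exact hV.elim x
    | func f ts ih =>
      cases t with
      | var x => exact hV.elim x
      | func f' ts' =>
        simp only [Term.relabel, Term.func.injEq] at h
        obtain ⟨rfl, h1, h2⟩ := h
        cases h1
        congr 1
        ext1 i
        exact ih i (congrFun (eq_of_heq h2) i)
  · have := congrArg (Term.relabel (Function.invFun g)) h
    simpa [Term.relabel_relabel, Function.invFun_comp hg] using this

/-! ### Contexts -/

namespace Ctx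

/-- Composition of contexts. -/
def comp : Ctx L V → Ctx L V → Ctx L V
  | hole, D => D
  | func f i ts C, D => func f i ts (C.comp D)

theorem fill_comp (C D : Ctx L V) (t : L.Term V) : (C.comp D).fill t = C.fill (D.fill t) := by
  induction C with
  | hole => rfl
  | func f i ts C ih => simp only [comp, fill, ih]

theorem subst_fill {W : Type*} (C : Ctx L V) (t : L.Term V) (σ : V → L.Term W) :
    (C.fill t).subst σ = (C.subst σ).fill (t.subst σ) := by
  induction C with
  | hole => rfl
  | func f i ts C ih =>
    simp only [fill, subst, Term.subst]
    congr 1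
    ext1 j
    by_cases h : j = i
    · subst h; simp [ih]
    · simp [h]

theorem subst_ne_hole {W : Type*} {C : Ctx L V} (hC : C ≠ hole) (σ : V → L.Term W) :
    C.subst σ ≠ hole := by
  cases C with
  | hole => exact absurd rfl hC
  | func => simp [subst]

end Ctx

/-! ### Equality modulo a theory -/

namespace EqMod

variable {E E₁ : Set (Rule L X)}

theorem mono (hE : E ⊆ E₁) {V : Type*} {s t : L.Term V} (h : EqMod E s t) : EqMod E₁ s t := by
  induction h with
  | refl t => exact refl t
  | symm _ ih => exact ih.symm
  | trans _ _ ih₁ ih₂ => exact ih₁.trans ih₂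
  | inst h σ => exact inst (hE h) σ
  | congr f ts us _ ih => exact congr f ts us ih

theorem subst {V W : Type*} {s t : L.Term V} (h : EqMod E s t) (τ : V → L.Term W) :
    EqMod E (s.subst τ) (t.subst τ) := by
  induction h with
  | refl t => exact refl _
  | symm _ ih => exact ih.symm
  | trans _ _ ih₁ ih₂ => exact ih₁.trans ih₂
  | inst h σ =>
    rw [subst_subst, subst_subst]
    exact inst h _
  | congr f ts us _ ih => exact congr f _ _ ih

theorem relabel {V W : Type*} {s t : L.Term V} (h : EqMod E s t) (g : V → W) :
    EqMod E (s.relabel g) (t.relabel g) := by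
  simpa only [relabel_eq_subst] using h.subst _

theorem subst_congr {V W : Type*} {t : L.Term V} {σ τ : V → L.Term W}
    (h : ∀ x ∈ varSet t, EqMod E (σ x) (τ x)) : EqMod E (t.subst σ) (t.subst τ) := by
  induction t with
  | var x => exact h x (by simp)
  | func f ts ih =>
    exact congr f _ _ fun i => ih i fun x hx => h x (by simpa using ⟨i, hx⟩)

theorem update {n : ℕ} (f : L.Functions n) {V : Type*} {ts us : Fin n → L.Term V} (i : Fin n)
    {s t : L.Term V} (h : ∀ j, j ≠ i → EqMod E (ts j) (us j)) (hst : EqMod E s t) :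
    EqMod E (Term.func f (Function.update ts i s)) (Term.func f (Function.update us i t)) := by
  refine congr f _ _ fun j => ?_
  by_cases hj : j = i
  · subst hj; simpa using hst
  · simpa [hj] using h j hj

theorem fill (C : Ctx L V) {s t : L.Term V} (h : EqMod E s t) :
    EqMod E (C.fill s) (C.fill t) := by
  induction C with
  | hole => exact h
  | func f i ts C ih => exact update f i (fun _ _ => refl _) ih

end EqMod

namespace EqBelow

variable {E : Set (Rule L X)}

theorem eqMod {V : Type*} {s t : L.Term V} (h : EqBelow E s t) : EqMod E s t := by
  cases h with
  | var => exact .refl _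
  | func f ts us h => exact .congr f ts us h

theorem refl {V : Type*} (t : L.Term V) : EqBelow E t t := by
  cases t with
  | var => exact .var _
  | func f ts => exact .func f _ _ fun _ => .refl _

theorem symm {V : Type*} {s t : L.Term V} (h : EqBelow E s t) : EqBelow E t s := by
  cases h with
  | var => exact .var _
  | func f ts us h => exact .func f _ _ fun i => (h i).symm

theorem trans {V : Type*} {s t r : L.Term V} (h : EqBelow E s t) (h' : EqBelow E t r) :
    EqBelow E s r := by
  cases h with
  | var => exact h'
  | func f ts us h =>
    cases h' with
    | func _ _ vs h' => exact .func f _ _ fun i => (h i).trans (h' i)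

theorem subst {V W : Type*} {s t : L.Term V} (h : EqBelow E s t) (τ : V → L.Term W) :
    EqBelow E (s.subst τ) (t.subst τ) := by
  cases h with
  | var => exact refl _
  | func f ts us h => exact .func f _ _ fun i => (h i).subst τ

theorem subst_congr {V W : Type*} {t : L.Term V} (ht : ∀ x, t ≠ Term.var x) {σ τ : V → L.Term W}
    (h : ∀ x ∈ varSet t, EqMod E (σ x) (τ x)) : EqBelow E (t.subst σ) (t.subst τ) := by
  cases t with
  | var x => exact absurd rfl (ht x)
  | func f ts =>
    exact .func f _ _ fun i => .subst_congr fun x hx => h x (by simpa using ⟨i, hx⟩)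

end EqBelow

theorem Rew.eqMod {E Rd : Set (Rule L X)} (hE : Rd ⊆ E) {s t : L.Term V} (h : Rew Rd s t) :
    EqMod E s t := by
  obtain ⟨ρ, hρ, C, σ, rfl, rfl⟩ := h
  exact .fill C (.inst (hE hρ) σ)

theorem RewClass.subst {Rd Ed : Set (Rule L X)} {s t : L.Term V} (h : RewClass Rd Ed s t)
    {W : Type*} (τ : V → L.Term W) : RewClass Rd Ed (s.subst τ) (t.subst τ) := by
  obtain ⟨s', hs, ρ, hρ, C, σ, rfl, rfl⟩ := h
  refine ⟨_, hs.subst τ, ρ, hρ, C.subst τ, fun x => (σ x).subst τ, ?_, ?_⟩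
  · rw [Ctx.subst_fill, subst_subst]
  · rw [Ctx.subst_fill, subst_subst]

theorem RewClass.eqMod {E Rd Ed : Set (Rule L X)} (hR : Rd ⊆ E) (hE : Ed ⊆ E) {s t : L.Term V}
    (h : RewClass Rd Ed s t) : EqMod E s t := by
  obtain ⟨s', hs, h⟩ := h
  exact (hs.mono hE).trans (h.eqMod hR)

/-! ### Finite equivalence classes -/

/-- The number of symbols of a term. -/
def termSize {V : Type*} : L.Term V → ℕ
  | .var _ => 1
  | .func _ ts => 1 + ∑ i, termSize (ts i)

theorem termSize_lt_fill {C : Ctx L V} (hC : C ≠ .hole) (s : L.Term V) :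
    termSize s < termSize (C.fill s) := by
  induction C with
  | hole => exact absurd rfl hC
  | func f i ts C ih =>
    have h1 : termSize s ≤ termSize (C.fill s) := by
      by_cases h : C = .hole
      · subst h; exact le_rfl
      · exact (ih h).le
    have h2 := Finset.single_le_sum (f := fun j => termSize (Function.update ts i (C.fill s) j))
      (fun _ _ => Nat.zero_le _) (Finset.mem_univ i)
    simp only [Function.update_self] at h2
    simp only [Ctx.fill, termSize]
    omega

/-- A term is not equal to a strict subterm of itself when the classes are finite: otherwise the
class would be closed under wrapping in the context, and hence contain arbitrarily large terms. -/
theorem not_eqMod_fill {Ed : Set (Rule L X)} (hfin : ∀ t : L.Term V, {s | EqMod Ed t s}.Finite)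
    {C : Ctx L V} (hC : C ≠ .hole) (s : L.Term V) : ¬ EqMod Ed s (C.fill s) := by
  intro h
  obtain ⟨m, hm, hmax⟩ := (hfin s).exists_maximalFor termSize _ ⟨s, EqMod.refl s⟩
  have := hmax (j := C.fill m) (h.trans (hm.fill C)) (termSize_lt_fill hC m).le
  exact absurd this (termSize_lt_fill hC m).not_ge

/-- Equations whose classes are finite preserve the variables: a variable occurring on one side only
could be replaced by infinitely many others. -/
theorem EqMod.varSet_eq [Infinite X] {Ed : Set (Rule L X)}
    (hfin : ∀ t : L.Term X, {s | EqMod Ed t s}.Finite) {s t : L.Term X} (h : EqMod Ed s t) :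
    varSet s = varSet t := by
  classical
  have key : ∀ {s t : L.Term X}, EqMod Ed s t → varSet s ⊆ varSet t := by
    intro s t h x hx
    by_contra hxt
    refine Set.infinite_univ (α := X) (((hfin t).biUnion fun s _ => finite_varSet s).subset ?_)
    intro y _
    have h1 := h.subst (Function.update Term.var x (Term.var y))
    have h2 : t.subst (Function.update Term.var x (Term.var y)) = t := by
      conv_rhs => rw [← subst_var t]
      refine RewTh.subst_congr fun z hz => ?_
      rw [Function.update_of_ne]
      rintro rfl
      exact hxt hz
    rw [h2] at h1
    refine Set.mem_biUnion (x := s.subst (Function.update Term.var x (Term.var y))) h1.symm ?_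
    rw [varSet_subst]
    exact Set.mem_biUnion hx (by simp)
  exact (key h).antisymm (key h.symm)

theorem exists_fill_var {x : V} {t : L.Term V} (hx : x ∈ varSet t) :
    ∃ C : Ctx L V, t = C.fill (Term.var x) := by
  induction t with
  | var y => exact ⟨.hole, by simpa [Ctx.fill] using (show x = y by simpa using hx).symm⟩
  | func f ts ih =>
    obtain ⟨i, hi⟩ : ∃ i, x ∈ varSet (ts i) := by simpa using hx
    obtain ⟨C, hC⟩ := ih i hi
    exact ⟨.func f i ts C, by simp [Ctx.fill, ← hC]⟩

theorem EqMod.eq_var [Infinite X] {Ed : Set (Rule L X)}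
    (hfin : ∀ t : L.Term X, {s | EqMod Ed t s}.Finite) {x : X} {t : L.Term X}
    (h : EqMod Ed (Term.var x) t) : t = Term.var x := by
  have hx : x ∈ varSet t := by rw [← h.varSet_eq hfin]; simp
  obtain ⟨C, rfl⟩ := exists_fill_var hx
  by_cases hC : C = .hole
  · subst hC; rfl
  · exact absurd h (not_eqMod_fill hfin hC _)

/-! ### Ordered rewriting on ground terms -/

/-- A set of rules `R`, together with the rules `Rd` and the equations `Ed`, and an order on a set of
terms which plays the role of the ground terms: the elements of `V` stand for the names. The order
is total modulo `Ed`, and decreases along the instances of `Rd`. -/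
structure GroundSystem (L : FirstOrder.Language.{u, v}) (X : Type w) (V : Type w') where
  gt : L.Term V → L.Term V → Prop
  R : Set (Rule L X)
  Rd : Set (Rule L X)
  Ed : Set (Rule L X)
  irrefl : ∀ s, ¬ gt s s
  trans : ∀ {s t u}, gt s t → gt t u → gt s u
  wf : WellFounded fun s t => gt t s
  ctx : ∀ (C : Ctx L V) {s t}, gt s t → gt (C.fill s) (C.fill t)
  compat : ∀ {s s' t' t}, EqMod Ed s s' → gt s' t' → EqMod Ed t' t → gt s t
  total : ∀ s t, gt s t ∨ gt t s ∨ EqMod Ed s t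
  finite : ∀ t : L.Term V, {s | EqMod Ed t s}.Finite
  decreasing : ∀ ρ ∈ Rd, ∀ σ : X → L.Term V, gt (ρ.1.subst σ) (ρ.2.subst σ)

namespace GroundSystem

variable (S : GroundSystem L X V)

/-- The preorder associated with the order: smaller, or equal modulo `Ed`. -/
def Le (s t : L.Term V) : Prop := S.gt t s ∨ EqMod S.Ed t s

variable {S} {a b c s t : L.Term V}

theorem Le.refl (s : L.Term V) : S.Le s s := .inr (.refl s)

theorem Le.of_eqMod (h : EqMod S.Ed s t) : S.Le s t := .inr h.symm

theorem Le.of_gt (h : S.gt t s) : S.Le s t := .inl h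

theorem gt_of_gt_of_le (h : S.gt a b) (h' : S.Le c b) : S.gt a c :=
  h'.elim (S.trans h) (S.compat (.refl _) h)

theorem gt_of_le_of_gt (h : S.Le a b) (h' : S.gt a c) : S.gt b c :=
  h.elim (fun h => S.trans h h') fun h => S.compat h h' (.refl _)

theorem Le.trans (h : S.Le a b) (h' : S.Le b c) : S.Le a c := by
  rcases h with h | h
  · exact .inl (gt_of_le_of_gt h' h)
  · rcases h' with h' | h'
    · exact .inl (S.compat (.refl _) h' h)
    · exact .inr (h'.trans h)

theorem not_gt_of_le (h : S.Le a b) : ¬ S.gt a b := fun h' => S.irrefl _ (gt_of_le_of_gt h h')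

theorem le_or_gt (a b : L.Term V) : S.Le a b ∨ S.gt a b := by
  rcases S.total a b with h | h | h
  · exact .inr h
  · exact .inl (.inl h)
  · exact .inl (.inr h.symm)

theorem le_total (a b : L.Term V) : S.Le a b ∨ S.Le b a :=
  (le_or_gt a b).imp_right .of_gt

theorem Le.fill (C : Ctx L V) (h : S.Le s t) : S.Le (C.fill s) (C.fill t) :=
  h.imp (S.ctx C) (EqMod.fill C)

theorem gt_of_fill_gt_fill {C : Ctx L V} (h : S.gt (C.fill s) (C.fill t)) : S.gt s t :=
  (le_or_gt s t).resolve_left fun h' => not_gt_of_le (h'.fill C) h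

/-- The order contains the strict subterm relation. -/
theorem fill_gt {C : Ctx L V} (hC : C ≠ .hole) (s : L.Term V) : S.gt (C.fill s) s := by
  -- Otherwise `s > C[s] > C[C[s]] > …`.
  have key : ∀ s, ¬ S.gt s (C.fill s) := fun s =>
    S.wf.induction (C := fun s => ¬ S.gt s (C.fill s)) s fun s ih h => ih _ h (S.ctx C h)
  rcases S.total s (C.fill s) with h | h | h
  · exact absurd h (key s)
  · exact h
  · exact absurd h (not_eqMod_fill S.finite hC s)

theorem le_fill (C : Ctx L V) (s : L.Term V) : S.Le s (C.fill s) := by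
  by_cases hC : C = .hole
  · subst hC; exact .refl _
  · exact .of_gt (fill_gt hC s)

theorem func_gt {n : ℕ} (f : L.Functions n) (ts : Fin n → L.Term V) (i : Fin n) :
    S.gt (Term.func f ts) (ts i) := by
  simpa [Ctx.fill] using fill_gt (S := S) (C := .func f i ts .hole) (by simp) (ts i)

theorem subst_le {V₀ : Type*} {x : V₀} {t : L.Term V₀} (hx : x ∈ varSet t) (σ : V₀ → L.Term V) :
    S.Le (σ x) (t.subst σ) := by
  obtain ⟨C, rfl⟩ := exists_fill_var hx
  rw [Ctx.subst_fill]
  exact le_fill _ _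

theorem update_gt {n : ℕ} (f : L.Functions n) (ts : Fin n → L.Term V) (i : Fin n)
    (h : S.gt (ts i) t) : S.gt (Term.func f ts) (Term.func f (Function.update ts i t)) := by
  simpa [Ctx.fill] using S.ctx (.func f i ts .hole) h

variable (S)

/-- One step of the equational theory of `R`, `Rd` and `Ed`: any number of applications of the
equations `Ed`, or one application of a rule of `R` or `Rd` in either direction. -/
def Step (s t : L.Term V) : Prop :=
  EqMod S.Ed s t ∨ ∃ ρ ∈ S.R ∪ S.Rd, ∃ (C : Ctx L V) (σ : X → L.Term V),
    (s = C.fill (ρ.1.subst σ) ∧ t = C.fill (ρ.2.subst σ)) ∨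
      (s = C.fill (ρ.2.subst σ) ∧ t = C.fill (ρ.1.subst σ))

/-- Equational proofs in which all terms satisfy `P`. -/
def Conn (P : L.Term V → Prop) : L.Term V → L.Term V → Prop :=
  ReflTransGen fun s t => P s ∧ P t ∧ S.Step s t

/-- Equational proofs in which all terms are at most `u`. -/
abbrev ConnLe (u : L.Term V) : L.Term V → L.Term V → Prop := S.Conn fun t => S.Le t u

/-- Equational proofs in which all terms are smaller than `u`. -/
abbrev ConnLt (u : L.Term V) : L.Term V → L.Term V → Prop := S.Conn fun t => S.gt u t

/-- A term is reducible if some proof that never exceeds it leads to a smaller term. -/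
def Red (s : L.Term V) : Prop := ∃ t, S.gt s t ∧ S.ConnLe s s t

/-- The immediate subterms are not reducible. -/
def SubNormal : L.Term V → Prop
  | .var _ => True
  | .func _ ts => ∀ i, ¬ S.Red (ts i)

/-- The pair `(s, t)` is an instance of a rule of `Q`, up to equality modulo `Ed`, which is applied
strictly below the root on the left. -/
def Inst (Q : Set (Rule L X)) (s t : L.Term V) : Prop :=
  ∃ ρ ∈ Q, ∃ σ : X → L.Term V, EqBelow S.Ed s (ρ.1.subst σ) ∧ EqMod S.Ed t (ρ.2.subst σ)

/-- `t` is obtained from `s` by reducing an immediate subterm. -/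
def Below (s t : L.Term V) : Prop :=
  ∃ (n : ℕ) (f : L.Functions n) (ss : Fin n → L.Term V) (i : Fin n) (p : L.Term V),
    s = Term.func f ss ∧ S.gt (ss i) p ∧ S.ConnLe (ss i) (ss i) p ∧
      t = Term.func f (Function.update ss i p)

variable {S} {P P' : L.Term V → Prop}

theorem Step.symm (h : S.Step s t) : S.Step t s := by
  rcases h with h | ⟨ρ, hρ, C, σ, h⟩
  · exact .inl h.symm
  · exact .inr ⟨ρ, hρ, C, σ, h.symm.imp And.symm And.symm⟩

theorem Step.fill (C : Ctx L V) (h : S.Step s t) : S.Step (C.fill s) (C.fill t) := by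
  rcases h with h | ⟨ρ, hρ, D, σ, h⟩
  · exact .inl (h.fill C)
  · refine .inr ⟨ρ, hρ, C.comp D, σ, ?_⟩
    simp only [Ctx.fill_comp]
    rcases h with ⟨rfl, rfl⟩ | ⟨rfl, rfl⟩
    · exact .inl ⟨rfl, rfl⟩
    · exact .inr ⟨rfl, rfl⟩

theorem Step.inst {ρ : Rule L X} (hρ : ρ ∈ S.R ∪ S.Rd) (σ : X → L.Term V) :
    S.Step (ρ.1.subst σ) (ρ.2.subst σ) :=
  .inr ⟨ρ, hρ, .hole, σ, .inl ⟨rfl, rfl⟩⟩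

theorem Conn.refl (s : L.Term V) : S.Conn P s s := ReflTransGen.refl

theorem Conn.trans (h : S.Conn P a b) (h' : S.Conn P b c) : S.Conn P a c :=
  ReflTransGen.trans h h'

theorem Conn.symm (h : S.Conn P a b) : S.Conn P b a := by
  induction h with
  | refl => exact .refl _
  | tail _ h ih => exact ReflTransGen.head ⟨h.2.1, h.1, h.2.2.symm⟩ ih

theorem Conn.step (ha : P a) (hb : P b) (h : S.Step a b) : S.Conn P a b :=
  ReflTransGen.single ⟨ha, hb, h⟩

theorem Conn.eqMod (ha : P a) (hb : P b) (h : EqMod S.Ed a b) : S.Conn P a b :=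
  .step ha hb (.inl h)

theorem Conn.mono (hP : ∀ t, P t → P' t) (h : S.Conn P a b) : S.Conn P' a b := by
  induction h with
  | refl => exact .refl _
  | tail _ h ih => exact ih.tail ⟨hP _ h.1, hP _ h.2.1, h.2.2⟩

theorem Conn.fill (C : Ctx L V) (hP : ∀ t, P t → P' (C.fill t)) (h : S.Conn P a b) :
    S.Conn P' (C.fill a) (C.fill b) := by
  induction h with
  | refl => exact .refl _
  | tail _ h ih => exact ih.tail ⟨hP _ h.1, hP _ h.2.1, h.2.2.fill C⟩

theorem ConnLe.fill (C : Ctx L V) (h : S.ConnLe c a b) :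
    S.ConnLe (C.fill c) (C.fill a) (C.fill b) :=
  Conn.fill C (fun _ h => h.fill C) h

theorem ConnLe.mono (h : S.ConnLe s a b) (hst : S.Le s t) : S.ConnLe t a b :=
  Conn.mono (fun _ h => h.trans hst) h

theorem ConnLe.connLt (h : S.ConnLe s a b) (hst : S.gt t s) : S.ConnLt t a b :=
  Conn.mono (fun _ h => gt_of_gt_of_le hst h) h

theorem ConnLt.mono (h : S.ConnLt s a b) (hst : S.Le s t) : S.ConnLt t a b :=
  Conn.mono (fun _ h => gt_of_le_of_gt hst h) h

theorem Red.congr (h : S.Red s) (hst : EqMod S.Ed s t) : S.Red t := by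
  obtain ⟨r, hr, hc⟩ := h
  have hle : S.Le s t := .of_eqMod hst
  exact ⟨r, gt_of_le_of_gt hle hr,
    (Conn.eqMod (P := fun r => S.Le r t) (.refl _) hle hst.symm).trans (ConnLe.mono hc hle)⟩

theorem Red.fill (C : Ctx L V) (h : S.Red s) : S.Red (C.fill s) := by
  obtain ⟨r, hr, hc⟩ := h
  exact ⟨_, S.ctx C hr, ConnLe.fill C hc⟩

theorem Red.subst {V₀ : Type*} {x : V₀} {t : L.Term V₀} (hx : x ∈ varSet t) {σ : V₀ → L.Term V}
    (h : S.Red (σ x)) : S.Red (t.subst σ) := by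
  obtain ⟨C, rfl⟩ := exists_fill_var hx
  rw [Ctx.subst_fill]
  exact h.fill _

theorem SubNormal.congr (h : S.SubNormal s) (hst : EqBelow S.Ed s t) : S.SubNormal t := by
  cases hst with
  | var => exact h
  | func f ts us h' => exact fun i hi => h i (hi.congr (h' i).symm)

theorem Inst.congr {Q : Set (Rule L X)} (h : S.Inst Q a b) (ha : EqBelow S.Ed a s)
    (hb : EqMod S.Ed b t) : S.Inst Q s t := by
  obtain ⟨ρ, hρ, σ, h1, h2⟩ := h
  exact ⟨ρ, hρ, σ, ha.symm.trans h1, hb.symm.trans h2⟩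

theorem Inst.mono {Q Q' : Set (Rule L X)} (h : S.Inst Q a b) (hQ : Q ⊆ Q') : S.Inst Q' a b := by
  obtain ⟨ρ, hρ, h⟩ := h
  exact ⟨ρ, hQ hρ, h⟩

theorem Below.gt (h : S.Below s t) : S.gt s t := by
  obtain ⟨n, f, ss, i, p, rfl, hp, _, rfl⟩ := h
  exact update_gt f ss i hp

theorem Below.connLe (h : S.Below s t) : S.ConnLe s s t := by
  obtain ⟨n, f, ss, i, p, rfl, hp, hc, rfl⟩ := h
  simpa [Ctx.fill] using ConnLe.fill (.func f i ss .hole) hc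

theorem Below.not_subNormal (h : S.Below s t) : ¬ S.SubNormal s := by
  obtain ⟨n, f, ss, i, p, rfl, hp, hc, rfl⟩ := h
  exact fun h => h i ⟨p, hp, hc⟩

/-- Reducing strictly below the root by a step in a nonempty context. -/
theorem below_fill {C : Ctx L V} (hC : C ≠ .hole) (h : S.gt a b) (hc : S.ConnLe a a b) :
    S.Below (C.fill a) (C.fill b) := by
  cases C with
  | hole => exact absurd rfl hC
  | func f i ts C =>
    refine ⟨_, f, Function.update ts i (C.fill a), i, C.fill b, rfl, ?_, ?_, ?_⟩
    · simpa using S.ctx C h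
    · simpa using ConnLe.fill C hc
    · simp [Ctx.fill]

theorem Below.congr {n : ℕ} {f : L.Functions n} {ss ts : Fin n → L.Term V}
    (hst : ∀ i, EqMod S.Ed (ss i) (ts i)) (h : S.Below (Term.func f ss) t) :
    ∃ t', S.Below (Term.func f ts) t' ∧ EqMod S.Ed t t' := by
  obtain ⟨n, f, ss, i, p, heq, hp, hc, rfl⟩ := h
  cases heq
  have hle : S.Le (ss i) (ts i) := .of_eqMod (hst i)
  refine ⟨_, ⟨_, f, ts, i, p, rfl, gt_of_le_of_gt hle hp,
    (Conn.eqMod (P := fun r => S.Le r (ts i)) (.refl _) hle (hst i).symm).trans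
      (ConnLe.mono hc hle), rfl⟩, ?_⟩
  exact .update f i (fun j _ => hst j) (.refl _)

/-- Several arguments of a function symbol may be reduced at once. -/
theorem connLe_func {n : ℕ} (f : L.Functions n) {ss ts : Fin n → L.Term V}
    (hle : ∀ i, S.Le (ts i) (ss i)) (hc : ∀ i, S.ConnLe (ss i) (ss i) (ts i)) :
    S.Le (Term.func f ts) (Term.func f ss) ∧
      S.ConnLe (Term.func f ss) (Term.func f ss) (Term.func f ts) := by
  classical
  have key : ∀ A : Finset (Fin n), S.Le (Term.func f (A.piecewise ts ss)) (Term.func f ss) ∧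
      S.ConnLe (Term.func f ss) (Term.func f ss) (Term.func f (A.piecewise ts ss)) := by
    intro A
    induction A using Finset.induction_on with
    | empty => exact ⟨by simpa using .refl _, by simpa using Conn.refl _⟩
    | insert i A hi ih =>
      rw [Finset.piecewise_insert]
      have h1 : A.piecewise ts ss = Function.update (A.piecewise ts ss) i (ss i) := by
        simp [hi]
      have h2 := (hle i).fill (.func f i (A.piecewise ts ss) .hole)
      have h3 := ConnLe.fill (.func f i (A.piecewise ts ss) .hole) (hc i)
      simp only [Ctx.fill] at h2 h3
      rw [← h1] at h2 h3
      exact ⟨h2.trans ih.1, ih.2.trans (ConnLe.mono h3 ih.1)⟩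
  simpa using key Finset.univ

theorem connLe_subst {V₀ : Type*} (t : L.Term V₀) {σ τ : V₀ → L.Term V}
    (hle : ∀ x, S.Le (τ x) (σ x)) (hc : ∀ x, S.ConnLe (σ x) (σ x) (τ x)) :
    S.Le (t.subst τ) (t.subst σ) ∧ S.ConnLe (t.subst σ) (t.subst σ) (t.subst τ) := by
  induction t with
  | var x => exact ⟨hle x, hc x⟩
  | func f ts ih => exact connLe_func f (fun i => (ih i).1) fun i => (ih i).2

/-- Reducing the substitution in one argument only bounds, and is connected to, reducing it in all
arguments. -/
theorem le_update_subst {V₀ : Type*} {n : ℕ} (f : L.Functions n) (ts : Fin n → L.Term V₀)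
    (i : Fin n) {σ τ : V₀ → L.Term V}
    (hle : ∀ x, S.Le (τ x) (σ x)) (hc : ∀ x, S.ConnLe (σ x) (σ x) (τ x)) :
    let u := Term.func f (Function.update (fun j => (ts j).subst σ) i ((ts i).subst τ))
    S.Le ((Term.func f ts).subst τ) u ∧ S.ConnLe u u ((Term.func f ts).subst τ) := by
  refine connLe_func f (fun j => ?_) (fun j => ?_)
  · by_cases hj : j = i
    · subst hj; simpa using .refl _
    · simpa [hj] using (connLe_subst (ts j) hle hc).1
  · by_cases hj : j = i
    · subst hj; simpa using Conn.refl _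
    · simpa [hj] using (connLe_subst (ts j) hle hc).2

theorem subst_gt {V₀ : Type*} {x : V₀} {t : L.Term V₀} (hx : x ∈ varSet t) {σ τ : V₀ → L.Term V}
    (hle : ∀ x, S.Le (τ x) (σ x)) (hc : ∀ x, S.ConnLe (σ x) (σ x) (τ x)) (h : S.gt (σ x) (τ x)) :
    S.gt (t.subst σ) (t.subst τ) := by
  induction t with
  | var y =>
    obtain rfl : x = y := by simpa using hx
    exact h
  | func f ts ih =>
    obtain ⟨i, hi⟩ : ∃ i, x ∈ varSet (ts i) := by simpa using hx
    exact gt_of_gt_of_le (update_gt f (fun j => (ts j).subst σ) i (ih i hi))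
      (le_update_subst f ts i hle hc).1

/-- Reducing the value of a variable `x` of a non-variable term amounts to reducing the instance
below the root, followed by a proof with smaller terms. -/
theorem exists_below_subst {V₀ : Type*} {x : V₀} {t : L.Term V₀} (ht : ∀ y, t ≠ Term.var y)
    (hx : x ∈ varSet t) {σ τ : V₀ → L.Term V} (hle : ∀ x, S.Le (τ x) (σ x))
    (hc : ∀ x, S.ConnLe (σ x) (σ x) (τ x)) (h : S.gt (σ x) (τ x)) :
    ∃ r, S.Below (t.subst σ) r ∧ S.ConnLt (t.subst σ) r (t.subst τ) := by
  cases t with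
  | var y => exact absurd rfl (ht y)
  | func f ts =>
    obtain ⟨i, hi⟩ : ∃ i, x ∈ varSet (ts i) := by simpa using hx
    have hb : S.Below ((Term.func f ts).subst σ) _ := ⟨_, f, _, i, (ts i).subst τ, rfl,
      subst_gt hi hle hc h, (connLe_subst (ts i) hle hc).2, rfl⟩
    exact ⟨_, hb, ConnLe.connLt (le_update_subst f ts i hle hc).2 hb.gt⟩

/-- A reducible instance of a term is reducible inside the substitution, or at a non-variable
position of the term; a lowest such position is returned. -/
theorem Red.locate {V₀ : Type*} {t : L.Term V₀} {σ : V₀ → L.Term V} (h : S.Red (t.subst σ)) :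
    (∃ x ∈ varSet t, S.Red (σ x)) ∨ ∃ (C : Ctx L V₀) (s : L.Term V₀), t = C.fill s ∧
      (∀ x, s ≠ Term.var x) ∧ S.Red (s.subst σ) ∧ S.SubNormal (s.subst σ) := by
  induction t with
  | var x => exact .inl ⟨x, by simp, h⟩
  | func f ts ih =>
    by_cases hs : ∃ i, S.Red ((ts i).subst σ)
    · obtain ⟨i, hi⟩ := hs
      refine (ih i hi).imp ?_ ?_
      · rintro ⟨x, hx, hr⟩
        exact ⟨x, by simpa using ⟨i, hx⟩, hr⟩
      · rintro ⟨C, s, hC, hs⟩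
        exact ⟨.func f i ts C, s, by simp [Ctx.fill, ← hC], hs⟩
    · exact .inr ⟨.hole, _, rfl, by simp, h, fun i hi => hs ⟨i, hi⟩⟩

end GroundSystem

/-! ### Instances of overlaps -/

theorem varSet_subset_fill (C : Ctx L V) (s : L.Term V) : varSet s ⊆ varSet (C.fill s) := by
  induction C with
  | hole => exact subset_rfl
  | func f i ts C ih =>
    intro x hx
    simp only [Ctx.fill, varSet_func, Set.mem_iUnion]
    exact ⟨i, by simpa using ih hx⟩

theorem EqMod.ctx_subst_congr {E : Set (Rule L X)} {W : Type*} (C : Ctx L X) {s : L.Term X}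
    {σ τ : X → L.Term W} (h : ∀ x ∈ varSet (C.fill s), EqMod E (σ x) (τ x)) {a b : L.Term W}
    (hab : EqMod E a b) : EqMod E ((C.subst σ).fill a) ((C.subst τ).fill b) := by
  induction C with
  | hole => exact hab
  | func f i ts C ih =>
    simp only [Ctx.fill, varSet_func, Set.mem_iUnion, forall_exists_index] at h
    refine .update f i (fun j hj => .subst_congr fun x hx => h x j ?_) (ih fun x hx => h x i ?_)
    · simpa [hj] using hx
    · simpa using hx

theorem Ctx.subst_subst {W U : Type*} (C : Ctx L V) (σ : V → L.Term W) (τ : W → L.Term U) :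
    (C.subst σ).subst τ = C.subst fun x => (σ x).subst τ := by
  induction C with
  | hole => rfl
  | func f i ts C ih => simp only [Ctx.subst, ih, RewTh.subst_subst]

theorem finite_ruleVars (ρ : Rule L X) : (ruleVars ρ).Finite :=
  (finite_varSet _).union (finite_varSet _)

theorem exists_injOn_of_finite {V X : Type*} [Infinite X] {A : Set V} (hA : A.Finite) :
    ∃ ι : V → X, Set.InjOn ι A := by
  classical
  have := hA.to_subtype
  obtain ⟨g, hg⟩ := exists_injective_nat A
  let y : X := Infinite.natEmbedding X 0
  refine ⟨fun v => if h : v ∈ A then Infinite.natEmbedding X (g ⟨v, h⟩) else y, ?_⟩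
  intro a ha b hb h
  simp only [ha, hb, dif_pos, EmbeddingLike.apply_eq_iff_eq] at h
  simpa using hg h

/-- The lifting property of overlap sets: if an instance of `ρ₂` applies, up to equality modulo `E`,
at the chosen position of an instance of the right-hand side of `ρ₁`, then the composed step is an
instance of a rule of the overlap set. The terms substituted for the variables may contain elements
of `V` (names), whereas unifiers take values in terms over `X`; the finitely many names involved are
represented by variables. -/
theorem IsOverlapSet.lift [Infinite X] [Nonempty V] {E : Set (Rule L X)} {ρ₁ ρ₂ : Rule L X}
    {C : Ctx L X} {s : L.Term X} {O : Set (Rule L X)} (hO : IsOverlapSet E ρ₁ C s ρ₂ O)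
    (hs : ρ₁.2 = C.fill s) {τ σ : X → L.Term V} (h : EqMod E (s.subst τ) (ρ₂.1.subst σ)) :
    ∃ ρ ∈ O, ∃ δ : X → L.Term V, EqMod E (ρ₁.1.subst τ) (ρ.1.subst δ) ∧
      ((∀ x, ρ₁.1 ≠ Term.var x) → EqBelow E (ρ₁.1.subst τ) (ρ.1.subst δ)) ∧
      EqMod E ((C.subst τ).fill (ρ₂.2.subst σ)) (ρ.2.subst δ) := by
  classical
  obtain ⟨π, hdisj, U, hU, rfl⟩ := hO
  set ρ₂' := renameRule ρ₂ π with hρ₂'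
  let γ : X → L.Term V := fun x => if x ∈ ruleVars ρ₁ then τ x else σ (π.symm x)
  have hγ₁ : ∀ x ∈ ruleVars ρ₁, γ x = τ x := fun x hx => if_pos hx
  have hγ₂ : ∀ t : L.Term X, varSet (t.relabel π) ⊆ ruleVars ρ₂' →
      (t.relabel π).subst γ = t.subst σ := by
    intro t ht
    rw [subst_relabel]
    refine subst_congr fun x hx => ?_
    have hx' : π x ∈ ruleVars ρ₂' := ht (by rw [varSet_relabel]; exact ⟨x, hx, rfl⟩)
    have : π x ∉ ruleVars ρ₁ := fun h => Set.disjoint_left.1 hdisj h hx'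
    simp [γ, this]
  have hfinW : (ruleVars ρ₁ ∪ ruleVars ρ₂').Finite := (finite_ruleVars _).union (finite_ruleVars _)
  obtain ⟨ι, hι⟩ := exists_injOn_of_finite (X := X) (hfinW.biUnion fun x _ => finite_varSet (γ x))
  let back : X → L.Term V := fun x =>
    Term.var (Function.invFunOn ι (⋃ x ∈ ruleVars ρ₁ ∪ ruleVars ρ₂', varSet (γ x)) x)
  have hback : ∀ x ∈ ruleVars ρ₁ ∪ ruleVars ρ₂', ((γ x).relabel ι).subst back = γ x := by
    intro x hx
    rw [subst_relabel]
    conv_rhs => rw [← subst_var (γ x)]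
    refine subst_congr fun a ha => ?_
    exact congrArg Term.var (hι.leftInvOn_invFunOn (Set.mem_biUnion hx ha))
  have hsv : varSet s ⊆ ruleVars ρ₁ :=
    (varSet_subset_fill C s).trans (hs ▸ Set.subset_union_right)
  have hunif : EqMod E (s.subst fun x => (γ x).relabel ι)
      (ρ₂'.1.subst fun x => (γ x).relabel ι) := by
    rw [← relabel_subst, ← relabel_subst, subst_congr fun x hx => hγ₁ x (hsv hx),
      show ρ₂'.1 = ρ₂.1.relabel π from rfl, hγ₂ _ Set.subset_union_left]
    exact h.relabel ι
  obtain ⟨θ, hθ, δ, hδ⟩ := hU.complete _ hunif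
  have key : ∀ x ∈ ruleVars ρ₁ ∪ ruleVars ρ₂',
      EqMod E (γ x) ((θ x).subst fun y => (δ y).subst back) := by
    intro x hx
    have := (hδ x hx).subst back
    rwa [hback x hx, subst_subst] at this
  have key₁ : ∀ x ∈ ruleVars ρ₁, EqMod E (τ x) ((θ x).subst fun y => (δ y).subst back) :=
    fun x hx => hγ₁ x hx ▸ key x (.inl hx)
  refine ⟨_, ⟨θ, hθ, rfl⟩, fun y => (δ y).subst back, ?_, fun hvar => ?_, ?_⟩
  · rw [subst_subst]
    exact .subst_congr fun x hx => key₁ x (.inl hx)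
  · rw [subst_subst]
    exact .subst_congr hvar fun x hx => key₁ x (.inl hx)
  · rw [Ctx.subst_fill, Ctx.subst_subst, subst_subst]
    refine .ctx_subst_congr C (fun x hx => key₁ x (.inr (hs ▸ hx))) ?_
    rw [← hγ₂ ρ₂.2 Set.subset_union_right]
    exact .subst_congr fun x hx => key x (.inr (.inr hx))

namespace GroundSystem

variable {S : GroundSystem L X V}

/-! ### Rules whose right-hand side is a new variable -/

theorem varSet_subset_of_mem_Rd [Nonempty V] {ρ : Rule L X} (hρ : ρ ∈ S.Rd) :
    varSet ρ.2 ⊆ varSet ρ.1 := by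
  classical
  intro y hy
  by_contra hy'
  -- The variable `y` may take the value of the left-hand side, which does not depend on `y`.
  let a : X → L.Term V := fun _ => Term.var (Classical.arbitrary V)
  let σ := Function.update a y (ρ.1.subst a)
  have h1 : ρ.1.subst σ = ρ.1.subst a := subst_congr fun x hx => by
    refine Function.update_of_ne ?_ _ _
    rintro rfl
    exact hy' hx
  have h2 : S.Le (σ y) (ρ.2.subst σ) := subst_le hy σ
  refine not_gt_of_le h2 ?_
  simpa [σ, h1] using S.decreasing ρ hρ σ

theorem not_rewClass_var [Infinite X] [Nonempty V]
    (hfin : ∀ t : L.Term X, {s | EqMod S.Ed t s}.Finite) (x : X) (t : L.Term X) :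
    ¬ RewClass S.Rd S.Ed (Term.var x) t := by
  classical
  rintro ⟨s, hs, ρ, hρ, C, σ, rfl, -⟩
  have h := hs.eq_var hfin
  cases C with
  | func f i ts C => simp [Ctx.fill] at h
  | hole =>
    obtain ⟨l, r⟩ := ρ
    cases l with
    | func f ts => simp [Ctx.fill, Term.subst] at h
    | var y =>
      let a : X → L.Term V := fun _ => Term.var (Classical.arbitrary V)
      let τ := Function.update a y (r.subst a)
      have h1 : S.gt (τ y) (r.subst τ) := S.decreasing _ hρ τ
      by_cases hy : y ∈ varSet r
      · exact not_gt_of_le (subst_le hy τ) h1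
      · have h2 : r.subst τ = r.subst a := subst_congr fun x hx => by
          refine Function.update_of_ne ?_ _ _
          rintro rfl
          exact hy hx
        rw [h2] at h1
        exact S.irrefl _ (by simpa [τ] using h1)

theorem varSet_subset_of_rewClass [Infinite X] [Nonempty V]
    (hfin : ∀ t : L.Term X, {s | EqMod S.Ed t s}.Finite) {s t : L.Term X}
    (h : RewClass S.Rd S.Ed s t) : varSet t ⊆ varSet s := by
  obtain ⟨s', hs, ρ, hρ, C, σ, rfl, rfl⟩ := h
  rw [hs.varSet_eq hfin]
  clear hs
  induction C with
  | hole =>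
    simp only [Ctx.fill, varSet_subst]
    exact Set.biUnion_subset_biUnion_left (varSet_subset_of_mem_Rd hρ)
  | func f i ts C ih =>
    simp only [Ctx.fill, varSet_func]
    refine Set.iUnion_mono fun j => ?_
    by_cases hj : j = i
    · subst hj; simpa using ih
    · simp [hj]

/-- Some rule of the set has a right-hand side that is a variable not occurring on the left. -/
def HasNewVar (Q : Set (Rule L X)) : Prop := ∃ l x, (l, Term.var x) ∈ Q ∧ x ∉ varSet l

/-- Normalisation cannot remove all rules that have a new variable as right-hand side. -/
theorem hasNewVar_of_normStep [Infinite X] [Nonempty V]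
    (hfin : ∀ t : L.Term X, {s | EqMod S.Ed t s}.Finite) {Q Q' : Set (Rule L X)}
    (h : NormStep S.Rd S.Ed Q Q') (hQ : HasNewVar Q) : HasNewVar Q' := by
  obtain ⟨l₀, x, hmem, hx⟩ := hQ
  cases h with
  | normR K l r r' h =>
    rcases hmem with hmem | hmem
    · exact ⟨_, _, .inl hmem, hx⟩
    · cases hmem
      exact absurd h (not_rewClass_var hfin x r')
  | normL K f ls j l' r h =>
    rcases hmem with hmem | hmem
    · exact ⟨_, _, .inl hmem, hx⟩
    · cases hmem
      refine ⟨_, _, .inr (.inl rfl), fun hx' => hx ?_⟩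
      simp only [varSet_func, Set.mem_iUnion] at hx' ⊢
      obtain ⟨i, hi⟩ := hx'
      refine ⟨i, ?_⟩
      by_cases hij : i = j
      · subst hij
        exact varSet_subset_of_rewClass hfin h (by simpa using hi)
      · simpa [hij] using hi
  | eq _ l r h =>
    rcases hmem with hmem | hmem
    · exact ⟨_, _, hmem, hx⟩
    · cases hmem
      rw [h.varSet_eq hfin] at hx
      simp at hx
  | sub _ l r l' r' C σ hK hl hr _ _ =>
    rcases hmem with hmem | hmem
    · exact ⟨_, _, hmem, hx⟩
    · cases hmem
      have h := hr.symm.eq_var hfin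
      cases C with
      | func f i ts C => simp [Ctx.fill] at h
      | hole =>
        cases r' with
        | func f ts => simp [Ctx.fill, Term.subst] at h
        | var y =>
          refine ⟨l', y, hK, fun hy => hx ?_⟩
          rw [← hl.eqMod.varSet_eq hfin, Ctx.fill, varSet_subst]
          exact Set.mem_biUnion hy (by simp [show σ y = Term.var x from h])

/-! ### Rules that survive normalisation -/

/-- The instances of the rules of `Q` are accounted for by the rules `R` of the system: they have
equational proofs in which all terms are bounded by one of the two sides, and a decreasing instance
is simulated by an instance of `R` with the same left-hand side and a right-hand side at most as
large, or by a reduction below the root. -/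
structure Covered (S : GroundSystem L X V) (Q : Set (Rule L X)) : Prop where
  bounded : ∀ ρ ∈ Q, ∀ σ : X → L.Term V,
    S.Conn (fun t => S.Le t (ρ.1.subst σ) ∨ S.Le t (ρ.2.subst σ)) (ρ.1.subst σ) (ρ.2.subst σ)
  traced : ∀ s t, S.Inst Q s t → S.gt s t →
    (∃ t', S.Le t' t ∧ S.Inst S.R s t' ∧ S.ConnLt s t t') ∨ ∃ r, S.Below s r ∧ S.ConnLt s t r

theorem Covered.mono {Q Q' : Set (Rule L X)} (h : S.Covered Q') (hQ : Q ⊆ Q') : S.Covered Q :=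
  ⟨fun ρ hρ => h.bounded ρ (hQ hρ), fun s t hi => h.traced s t (hi.mono hQ)⟩

theorem covered_R : S.Covered S.R := by
  refine ⟨fun ρ hρ σ => .step (.inl (.refl _)) (.inr (.refl _)) (.inst (.inl hρ) σ), ?_⟩
  exact fun s t h _ => .inl ⟨t, .refl _, h, .refl _⟩

theorem RewClass.gt {s t : L.Term V} (h : RewClass S.Rd S.Ed s t) : S.gt s t := by
  obtain ⟨s', hs, ρ, hρ, C, σ, rfl, rfl⟩ := h
  exact S.compat hs (S.ctx C (S.decreasing ρ hρ σ)) (.refl _)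

theorem RewClass.connLe {s t : L.Term V} (h : RewClass S.Rd S.Ed s t) : S.ConnLe s s t := by
  have hgt := RewClass.gt h
  obtain ⟨s', hs, ρ, hρ, C, σ, rfl, rfl⟩ := h
  have hle : S.Le (C.fill (ρ.1.subst σ)) s := .of_eqMod hs.symm
  exact (Conn.eqMod (P := fun r => S.Le r s) (.refl _) hle hs).trans
    (.step hle (.of_gt hgt) ((Step.inst (.inr hρ) σ).fill C))

theorem le_fill_or {C : Ctx L V} {a b t : L.Term V} (h : S.Le t a ∨ S.Le t b) :
    S.Le (C.fill t) (C.fill a) ∨ S.Le (C.fill t) (C.fill b) :=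
  h.imp (.fill C) (.fill C)

/-- Proofs bounded by the two sides only depend on the two sides modulo `Ed`. -/
theorem Conn.congr_bounds {a b a' b' : L.Term V} (ha : EqMod S.Ed a a') (hb : EqMod S.Ed b b')
    (h : S.Conn (fun t => S.Le t a ∨ S.Le t b) a b) :
    S.Conn (fun t => S.Le t a' ∨ S.Le t b') a' b' := by
  have ha' : S.Le a a' := .of_eqMod ha
  have hb' : S.Le b b' := .of_eqMod hb
  refine .trans (.eqMod (.inl (.refl _)) (.inl ha') ha.symm) (.trans ?_
    (.eqMod (.inr hb') (.inr (.refl _)) hb))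
  exact h.mono fun t ht => ht.imp (·.trans ha') (·.trans hb')

theorem Conn.connLe_of_le {a b : L.Term V} (h : S.Conn (fun t => S.Le t a ∨ S.Le t b) a b)
    (hba : S.Le b a) : S.ConnLe a a b :=
  h.mono fun _ ht => ht.elim id (·.trans hba)

theorem Conn.connLt_of_gt {a b c : L.Term V} (h : S.Conn (fun t => S.Le t a ∨ S.Le t b) a b)
    (ha : S.gt c a) (hb : S.gt c b) : S.ConnLt c a b :=
  h.mono fun _ ht => ht.elim (gt_of_gt_of_le ha) (gt_of_gt_of_le hb)

theorem ConnLe.conn {a b c : L.Term V} {Q : L.Term V → Prop} (h : S.ConnLe c a b)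
    (hQ : ∀ t, S.Le t c → Q t) : S.Conn Q a b := Conn.mono hQ h

theorem Covered.bounded_of_normStep {Q Q' : Set (Rule L X)} (h : NormStep S.Rd S.Ed Q Q')
    (hQ : S.Covered Q') : ∀ ρ ∈ Q, ∀ σ : X → L.Term V,
    S.Conn (fun t => S.Le t (ρ.1.subst σ) ∨ S.Le t (ρ.2.subst σ)) (ρ.1.subst σ)
      (ρ.2.subst σ) := by
  intro ρ hρ σ
  cases h with
  | normR K l r r' h =>
    rcases hρ with hρ | rfl
    · exact hQ.bounded _ (.inl hρ) σ
    · have h := h.subst σ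
      refine .trans ((hQ.bounded (l, r') (.inr rfl) σ).mono fun t ht => ht.imp_right fun ht =>
        ht.trans (.of_gt (RewClass.gt h))) (.symm ?_)
      exact (RewClass.connLe h).conn fun _ => .inr
  | normL K f ls j l' r h =>
    rcases hρ with hρ | rfl
    · exact hQ.bounded _ (.inl hρ) σ
    · have h := h.subst σ
      have e : (Term.func f (Function.update ls j l')).subst σ =
          Term.func f (Function.update (fun i => (ls i).subst σ) j (l'.subst σ)) := by
        simp only [Term.subst]
        congr 1
        ext1 i
        by_cases hi : i = j
        · subst hi; simp
        · simp [hi]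
      have hb : S.Below ((Term.func f ls).subst σ) ((Term.func f (Function.update ls j l')).subst σ) :=
        ⟨_, f, _, j, l'.subst σ, rfl, RewClass.gt h, RewClass.connLe h, e⟩
      refine .trans (hb.connLe.conn fun _ => .inl) ((hQ.bounded _ (.inr (.inl rfl)) σ).mono ?_)
      exact fun t ht => ht.imp_left fun ht => ht.trans (.of_gt hb.gt)
  | eq _ l r h =>
    rcases hρ with hρ | rfl
    · exact hQ.bounded _ hρ σ
    · exact .eqMod (.inl (.refl _)) (.inr (.refl _)) (h.subst σ)
  | sub _ l r l' r' C τ hK hl hr _ _ =>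
    rcases hρ with hρ | rfl
    · exact hQ.bounded _ hρ σ
    · have hl := (hl.subst σ).eqMod
      have hr := hr.subst σ
      rw [Ctx.subst_fill, subst_subst] at hl hr
      exact ((hQ.bounded _ hK _).fill (C.subst σ) fun t => le_fill_or).congr_bounds hl hr

theorem Covered.traced_of_normStep {Q Q' : Set (Rule L X)} (h : NormStep S.Rd S.Ed Q Q')
    (hQ : S.Covered Q') : ∀ s t, S.Inst Q s t → S.gt s t →
    (∃ t', S.Le t' t ∧ S.Inst S.R s t' ∧ S.ConnLt s t t') ∨
      ∃ r, S.Below s r ∧ S.ConnLt s t r := by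
  rintro s t ⟨ρ, hρ, σ, hs, ht⟩ hgt
  cases h with
  | normR K l r r' h =>
    rcases hρ with hρ | rfl
    · exact hQ.traced s t ⟨ρ, .inl hρ, σ, hs, ht⟩ hgt
    · have h := h.subst σ
      have htr : S.gt t (r'.subst σ) := S.compat ht (RewClass.gt h) (.refl _)
      have hc : S.ConnLt s t (r'.subst σ) :=
        .trans (.eqMod hgt (gt_of_gt_of_le hgt (.of_eqMod ht.symm)) ht)
          ((RewClass.connLe h).connLt (gt_of_gt_of_le hgt (.of_eqMod ht.symm)))
      rcases hQ.traced s (r'.subst σ) ⟨(l, r'), .inr rfl, σ, hs, .refl _⟩ (S.trans hgt htr) with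
        ⟨t', h1, h2, h3⟩ | ⟨q, h1, h2⟩
      · exact .inl ⟨t', h1.trans (.of_gt htr), h2, hc.trans h3⟩
      · exact .inr ⟨q, h1, hc.trans h2⟩
  | normL K f ls j l' r h =>
    rcases hρ with hρ | rfl
    · exact hQ.traced s t ⟨ρ, .inl hρ, σ, hs, ht⟩ hgt
    · have h := h.subst σ
      cases hs with
      | func _ ss _ hss =>
        -- The step on the argument `j` is a reduction below the root.
        right
        have hle : S.Le ((ls j).subst σ) (ss j) := .of_eqMod (hss j).symm
        have hb : S.Below (Term.func f ss) _ := ⟨_, f, ss, j, l'.subst σ, rfl,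
          gt_of_le_of_gt hle (RewClass.gt h),
          (Conn.eqMod (P := fun r => S.Le r (ss j)) (.refl _) hle (hss j)).trans
            ((RewClass.connLe h).mono hle), rfl⟩
        refine ⟨_, hb, ?_⟩
        have e : EqMod S.Ed ((Term.func f (Function.update ls j l')).subst σ)
            (Term.func f (Function.update ss j (l'.subst σ))) := by
          refine .congr f _ _ fun i => ?_
          by_cases hi : i = j
          · subst hi; simpa using .refl _
          · simpa [hi] using (hss i).symm
        have := ((hQ.bounded _ (.inr (.inl rfl)) σ).congr_bounds e ht.symm)
        exact (this.connLt_of_gt hb.gt hgt).symm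
  | eq _ l r h =>
    rcases hρ with hρ | rfl
    · exact hQ.traced s t ⟨ρ, hρ, σ, hs, ht⟩ hgt
    · exact absurd (S.compat (.refl s) hgt ((ht.trans (h.subst σ).symm).trans hs.eqMod.symm))
        (S.irrefl s)
  | sub _ l r l' r' C τ hK hl hr _ _ =>
    rcases hρ with hρ | rfl
    · exact hQ.traced s t ⟨ρ, hρ, σ, hs, ht⟩ hgt
    · have hl := hs.trans (hl.subst σ).symm
      have hr := ht.trans (hr.subst σ).symm
      rw [Ctx.subst_fill, subst_subst] at hl hr
      cases C with
      | hole => exact hQ.traced s t ⟨_, hK, _, hl, hr⟩ hgt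
      | func f i ts C =>
        -- The rule is applied strictly below the root: its instance must be decreasing.
        right
        have hgt' := S.compat hl.eqMod.symm hgt hr
        have hab := gt_of_fill_gt_fill hgt'
        have hb := below_fill (C := (Ctx.func f i ts C).subst σ) (by simp [Ctx.subst]) hab
          ((hQ.bounded _ hK _).connLe_of_le (.of_gt hab))
        simp only [Ctx.subst, Ctx.fill] at hb hl hr hgt'
        cases hl with
        | func _ ss _ hss =>
          obtain ⟨q, hq, hq'⟩ := hb.congr fun i => (hss i).symm
          exact ⟨q, hq, .eqMod hgt hq.gt (hr.trans hq')⟩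

theorem Covered.of_norm {Q Q' : Set (Rule L X)} (h : Norm S.Rd S.Ed Q Q') (hQ : S.Covered Q') :
    S.Covered Q := by
  induction h using ReflTransGen.head_induction_on with
  | refl => exact hQ
  | head h _ ih => exact ⟨ih.bounded_of_normStep h, ih.traced_of_normStep h⟩

theorem Covered.of_reachable {E' Q : Set (Rule L X)} (h : Reachable E' S.Rd S.Ed Q)
    (hQ : S.Covered Q) : S.Covered (initialRules E' S.Rd) := by
  induction h with
  | init h => exact hQ.of_norm h
  | loop _ _ h ih => exact ih ((hQ.of_norm h).mono Set.subset_union_left)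

end GroundSystem

namespace GroundSystem

variable {S : GroundSystem L X V} {a b s t : L.Term V}

/-! ### Saturated systems: reducible terms are reduced by `R` -/

/-- What the fixpoint reached by the procedure provides: `R'` is generated from `R` by one iteration,
the rules of `R ∪ R'` are accounted for by `R`, and so are those of a set `I` (the initial rules)
containing `Rd`. -/
structure IsSaturated (S : GroundSystem L X V) (R' I : Set (Rule L X)) : Prop where
  finite_classes : ∀ t : L.Term X, {s | EqMod S.Ed t s}.Finite
  generated : IsGenerated S.Ed S.R R'
  covered : S.Covered (S.R ∪ R')
  covered_init : S.Covered I
  Rd_subset : S.Rd ⊆ I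
  vars : ∀ ρ ∈ S.R, varSet ρ.2 ⊆ varSet ρ.1
  not_new_var : ∀ x r, (Term.var x, r) ∈ S.R → x ∈ varSet r

theorem Inst.connLe {Q : Set (Rule L X)} (hQ : S.Covered Q) (h : S.Inst Q s t) (hgt : S.gt s t) :
    S.ConnLe s s t := by
  obtain ⟨ρ, hρ, σ, hs, ht⟩ := h
  exact ((hQ.bounded ρ hρ σ).congr_bounds hs.eqMod.symm ht.symm).connLe_of_le (.of_gt hgt)

theorem Inst.red {Q : Set (Rule L X)} (hQ : S.Covered Q) (h : S.Inst Q s t) (hgt : S.gt s t) :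
    S.Red s := ⟨t, hgt, h.connLe hQ hgt⟩

namespace IsSaturated

variable {R' I : Set (Rule L X)}

/-- The left-hand side of a rule of `R` that has a decreasing instance is not a variable. -/
theorem exists_nonvar_of_inst (H : S.IsSaturated R' I) (h : S.Inst S.R s t) (hgt : S.gt s t) :
    ∃ ρ ∈ S.R, ∃ σ : X → L.Term V, (∀ x, ρ.1 ≠ Term.var x) ∧
      EqBelow S.Ed s (ρ.1.subst σ) ∧ EqMod S.Ed t (ρ.2.subst σ) := by
  obtain ⟨⟨l, r⟩, hρ, σ, hs, ht⟩ := h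
  refine ⟨_, hρ, σ, ?_, hs, ht⟩
  rintro x rfl
  exact not_gt_of_le (subst_le (H.not_new_var x r hρ) σ) (S.compat hs.eqMod.symm hgt ht)

/-- Composing an instance of `R` or `Ed` with an instance of `R` that applies to its right-hand
side. -/
theorem inst_of_overlap [Infinite X] [Nonempty V] (H : S.IsSaturated R' I) {ρ : Rule L X}
    (hρ : ρ ∈ S.R ∪ S.Ed ∪ Prod.swap '' S.Ed) (hvar : ∀ x, ρ.1 ≠ Term.var x) {C : Ctx L X}
    {p : L.Term X} (hp : ρ.2 = C.fill p) (hp' : ∀ x, p ≠ Term.var x) {σ : X → L.Term V}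
    (hs : EqBelow S.Ed s (ρ.1.subst σ)) (h : S.Inst S.R (p.subst σ) t) :
    S.Inst R' s ((C.subst σ).fill t) := by
  obtain ⟨ov, hov, rfl⟩ := H.generated
  obtain ⟨ρ₂, hρ₂, τ, h1, h2⟩ := h
  obtain ⟨ρ', hρ', δ, -, h3, h4⟩ := (hov ρ C p ρ₂ ⟨hp, hp'⟩).lift hp h1.eqMod
  exact ⟨ρ', .inl (.inr ⟨ρ, hρ, ρ₂, hρ₂, C, p, ⟨hp, hp'⟩, hρ'⟩), δ, hs.trans (h3 hvar),
    (h2.fill _).trans h4⟩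

/-- Two instances of `R`, one of which applies to the left-hand side of the other: the resulting
terms are connected by a proof that is bounded by the two terms. -/
theorem conn_of_overlap [Infinite X] [Nonempty V] (H : S.IsSaturated R' I) {ρ : Rule L X}
    (hρ : ρ ∈ S.R) {C : Ctx L X} {p : L.Term X} (hp : ρ.1 = C.fill p) (hp' : ∀ x, p ≠ Term.var x)
    {σ : X → L.Term V} (h : S.Inst S.R (p.subst σ) t) :
    S.Conn (fun u => S.Le u (ρ.2.subst σ) ∨ S.Le u ((C.subst σ).fill t)) (ρ.2.subst σ)
      ((C.subst σ).fill t) := by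
  obtain ⟨ov, hov, hR'⟩ := H.generated
  obtain ⟨ρ₂, hρ₂, τ, h1, h2⟩ := h
  obtain ⟨ρ', hρ', δ, h3, -, h4⟩ := (hov ρ.swap C p ρ₂ ⟨hp, hp'⟩).lift hp h1.eqMod
  have hmem : ρ' ∈ S.R ∪ R' := by
    rw [hR']
    exact .inr (.inl (.inl ⟨ρ, hρ, ρ₂, hρ₂, C, p, ⟨hp, hp'⟩, .inl hρ'⟩))
  exact (H.covered.bounded ρ' hmem δ).congr_bounds h3.symm ((h2.fill _).trans h4).symm

theorem swap_mem (H : S.IsSaturated R' I) {ρ : Rule L X} (hρ : ρ ∈ S.R) : ρ.swap ∈ R' := by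
  obtain ⟨ov, hov, rfl⟩ := H.generated
  exact .inr ⟨ρ, hρ, rfl⟩

/-- If `s` is reducible and its immediate subterms are not, then an instance of a rule of `R` reduces
`s` at the root to an irreducible term. -/
def Reduced (S : GroundSystem L X V) (s : L.Term V) : Prop :=
  S.Red s → S.SubNormal s → ∃ t, S.gt s t ∧ S.Inst S.R s t ∧ ¬ S.Red t

/-- A decreasing instance of `R ∪ R'` whose left-hand side has irreducible immediate subterms can be
replaced by an instance of `R` with an irreducible right-hand side: a least right-hand side is
irreducible, as otherwise an overlap on it would yield a smaller one. -/
theorem exists_inst_of_inst [Infinite X] [Nonempty V] (H : S.IsSaturated R' I)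
    (ih : ∀ t, S.gt s t → Reduced S t) (hs : S.SubNormal s) (h : S.Inst (S.R ∪ R') s t)
    (hgt : S.gt s t) : ∃ t, S.gt s t ∧ S.Inst S.R s t ∧ ¬ S.Red t := by
  have trace : ∀ t, S.Inst (S.R ∪ R') s t → S.gt s t →
      ∃ t', S.Le t' t ∧ S.Inst S.R s t' ∧ S.gt s t' := by
    intro t h hgt
    rcases H.covered.traced s t h hgt with ⟨t', h1, h2, -⟩ | ⟨r, hr, -⟩
    · exact ⟨t', h1, h2, gt_of_gt_of_le hgt h1⟩
    · exact absurd hs hr.not_subNormal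
  obtain ⟨t₀, -, ht₀⟩ := trace t h hgt
  obtain ⟨m, ⟨hm, hm'⟩, hmin⟩ := S.wf.has_min {t | S.Inst S.R s t ∧ S.gt s t} ⟨t₀, ht₀⟩
  refine ⟨m, hm', hm, fun hred => ?_⟩
  obtain ⟨ρ, hρ, σ, hvar, h1, h2⟩ := H.exists_nonvar_of_inst hm hm'
  rcases (hred.congr h2).locate with ⟨x, hx, hxr⟩ | ⟨C, p, hp, hp', hpr, hps⟩
  -- A variable of the right-hand side occurs below the root of the left-hand side, where nothing is
  -- reducible.
  · have hs' := hs.congr h1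
    have hx' := H.vars ρ hρ hx
    obtain ⟨l, r⟩ := ρ
    cases l with
    | var y => exact hvar y rfl
    | func f ls =>
      obtain ⟨i, hi⟩ : ∃ i, x ∈ varSet (ls i) := by simpa using hx'
      exact hs' i (hxr.subst hi)
  · have hle : S.Le (p.subst σ) (ρ.2.subst σ) := by
      rw [hp, Ctx.subst_fill]
      exact le_fill _ _
    have hle' : S.Le (ρ.2.subst σ) m := .of_eqMod h2.symm
    obtain ⟨q, hq, hq', -⟩ := ih _ (gt_of_gt_of_le hm' (hle.trans hle')) hpr hps
    have hgt' : S.gt m ((C.subst σ).fill q) := by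
      refine gt_of_le_of_gt hle' ?_
      rw [hp, Ctx.subst_fill]
      exact S.ctx _ hq
    obtain ⟨t', h3, h4, h5⟩ := trace _
      ((H.inst_of_overlap (.inl (.inl hρ)) hvar hp hp' h1 hq').mono Set.subset_union_right)
      (S.trans hm' hgt')
    exact hmin t' ⟨h4, h5⟩ (gt_of_gt_of_le hgt' h3)

/-- `t` is obtained from `s` by reducing an immediate subterm, or by a decreasing instance of
`R ∪ R'` at the root. -/
def Reducts (S : GroundSystem L X V) (R' : Set (Rule L X)) (s t : L.Term V) : Prop :=
  S.Below s t ∨ S.gt s t ∧ S.Inst (S.R ∪ R') s t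

theorem Reducts.gt (h : Reducts S R' s t) : S.gt s t := h.elim Below.gt And.left

theorem Reducts.red (H : S.IsSaturated R' I) (h : Reducts S R' s t) : S.Red s := by
  rcases h with h | ⟨h, h'⟩
  · exact ⟨t, h.gt, h.connLe⟩
  · exact h'.red H.covered h

theorem Reducts.of_subNormal (h : Reducts S R' s t) (hs : S.SubNormal s) :
    S.gt s t ∧ S.Inst (S.R ∪ R') s t := h.resolve_left fun h => h.not_subNormal hs

theorem Reducts.congr {n : ℕ} {f : L.Functions n} {ss ts : Fin n → L.Term V}
    (hst : ∀ i, EqMod S.Ed (ss i) (ts i)) (h : Reducts S R' (Term.func f ss) t) :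
    ∃ t', Reducts S R' (Term.func f ts) t' ∧ EqMod S.Ed t t' := by
  rcases h with h | ⟨h, h'⟩
  · obtain ⟨t', h1, h2⟩ := h.congr hst
    exact ⟨t', .inl h1, h2⟩
  · exact ⟨t, .inr ⟨S.compat (.congr f _ _ fun i => (hst i).symm) h (.refl _),
      h'.congr (.func f _ _ hst) (.refl _)⟩, .refl _⟩

/-- Reducts are obtained on both sides of an instance of an equation `g = d` of `Ed`, and they are
connected by smaller terms: either a variable is reduced, or a rule that applies to `gσ` has an
overlap with `d → g`. -/
theorem exists_reducts_of_equation [Infinite X] [Nonempty V] (H : S.IsSaturated R' I)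
    {g d : L.Term X} (hgd : (g, d) ∈ S.Ed ∪ Prod.swap '' S.Ed) {σ : X → L.Term V}
    (ih : ∀ t, S.gt (g.subst σ) t → Reduced S t)
    (hred : ∃ t, Reducts S R' (g.subst σ) t) :
    ∃ s t, Reducts S R' (g.subst σ) s ∧ Reducts S R' (d.subst σ) t ∧
      S.ConnLt (g.subst σ) s t := by
  classical
  have heq : EqMod S.Ed g d := by
    have key : ∀ σ : X → L.Term X, EqMod S.Ed (g.subst σ) (d.subst σ) := by
      intro σ
      rcases hgd with h | ⟨⟨d', g'⟩, h, h'⟩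
      · exact .inst h σ
      · cases h'
        exact (EqMod.inst h σ).symm
    simpa [subst_var] using key Term.var
  obtain ⟨t, ht⟩ := hred
  by_cases hg : ∃ x, g = Term.var x
  · obtain ⟨x, rfl⟩ := hg
    rw [heq.eq_var H.finite_classes]
    exact ⟨t, t, ht, ht, .refl _⟩
  by_cases hd : ∃ x, d = Term.var x
  · obtain ⟨x, rfl⟩ := hd
    rw [← heq.symm.eq_var H.finite_classes]
    exact ⟨t, t, ht, ht, .refl _⟩
  push Not at hg hd
  have hgdσ := heq.subst σ
  have hdg : S.Le (d.subst σ) (g.subst σ) := .of_eqMod hgdσ.symm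
  rcases (ht.red H).locate with ⟨x, hx, p, hp, hpc⟩ | ⟨C, p, hp, hp', hpr, hps⟩
  · let τ := Function.update σ x p
    have hle : ∀ y, S.Le (τ y) (σ y) := by
      intro y
      by_cases hy : y = x
      · subst hy; simpa [τ] using .of_gt hp
      · simpa [τ, hy] using .refl _
    have hc : ∀ y, S.ConnLe (σ y) (σ y) (τ y) := by
      intro y
      by_cases hy : y = x
      · subst hy; simpa [τ] using hpc
      · simpa [τ, hy] using Conn.refl _
    have hgt : S.gt (σ x) (τ x) := by simpa [τ] using hp
    obtain ⟨r, hr, hr'⟩ := exists_below_subst hg hx hle hc hgt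
    have hx' : x ∈ varSet d := heq.varSet_eq H.finite_classes ▸ hx
    obtain ⟨q, hq, hq'⟩ := exists_below_subst hd hx' hle hc hgt
    refine ⟨r, q, .inl hr, .inl hq, hr'.trans (.trans ?_ (hq'.mono hdg).symm)⟩
    exact .eqMod (subst_gt hx hle hc hgt) (gt_of_le_of_gt hdg (subst_gt hx' hle hc hgt))
      (heq.subst τ)
  · have hinst : ∃ q, S.gt (p.subst σ) q ∧ S.Inst S.R (p.subst σ) q := by
      by_cases hC : C = .hole
      · subst hC
        obtain rfl : g = p := hp
        obtain ⟨h1, h2⟩ := ht.of_subNormal hps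
        obtain ⟨q, h3, h4, -⟩ := H.exists_inst_of_inst ih hps h2 h1
        exact ⟨q, h3, h4⟩
      · obtain ⟨q, h3, h4, -⟩ := ih (p.subst σ)
          (by rw [hp, Ctx.subst_fill]; exact fill_gt (Ctx.subst_ne_hole hC σ) _) hpr hps
        exact ⟨q, h3, h4⟩
    obtain ⟨q, hq, hq'⟩ := hinst
    have hgt : S.gt (g.subst σ) ((C.subst σ).fill q) := by
      rw [hp, Ctx.subst_fill]
      exact S.ctx _ hq
    refine ⟨(C.subst σ).fill q, (C.subst σ).fill q, ?_, .inr ⟨S.compat hgdσ.symm hgt (.refl _), ?_⟩,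
      .refl _⟩
    · by_cases hC : C = .hole
      · subst hC
        obtain rfl : g = p := hp
        exact .inr ⟨hgt, hq'.mono Set.subset_union_left⟩
      · left
        rw [hp, Ctx.subst_fill]
        exact below_fill (Ctx.subst_ne_hole hC σ) hq (hq'.connLe covered_R hq)
    · have hmem : (d, g) ∈ S.R ∪ S.Ed ∪ Prod.swap '' S.Ed := by
        rcases hgd with h | ⟨⟨d', g'⟩, h, h'⟩
        · exact .inr ⟨_, h, rfl⟩
        · cases h'
          exact .inl (.inr h)
      exact (H.inst_of_overlap hmem hd hp hp' (.refl _) hq').mono Set.subset_union_right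

/-- Having a reduct only depends on the class of the term modulo `Ed`. -/
theorem exists_reducts_of_eqMod [Infinite X] [Nonempty V] (H : S.IsSaturated R' I)
    {c : L.Term V} (ih : ∀ t, S.gt c t → Reduced S t) (h : EqMod S.Ed a b) :
    EqMod S.Ed c a → ((∃ t, Reducts S R' a t) ↔ ∃ t, Reducts S R' b t) := by
  induction h with
  | refl => exact fun _ => Iff.rfl
  | symm h ih' => exact fun hc => (ih' (hc.trans h.symm)).symm
  | trans h _ ih₁ ih₂ => exact fun hc => (ih₁ hc).trans (ih₂ (hc.trans h))
  | @inst ρ h σ =>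
    intro hc
    have hc' := hc.trans (EqMod.inst h σ)
    constructor
    · intro hr
      obtain ⟨_, t, -, ht, -⟩ := H.exists_reducts_of_equation (g := ρ.1) (d := ρ.2) (.inl h)
        (fun t ht => ih t (S.compat hc ht (.refl _))) hr
      exact ⟨t, ht⟩
    · intro hr
      obtain ⟨_, t, -, ht, -⟩ := H.exists_reducts_of_equation (g := ρ.2) (d := ρ.1)
        (.inr ⟨ρ, h, rfl⟩) (fun t ht => ih t (S.compat hc' ht (.refl _))) hr
      exact ⟨t, ht⟩
  | congr f ts us h _ =>
    intro _
    constructor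
    · rintro ⟨t, ht⟩
      obtain ⟨t', ht', -⟩ := ht.congr h
      exact ⟨t', ht'⟩
    · rintro ⟨t, ht⟩
      obtain ⟨t', ht', -⟩ := ht.congr fun i => (h i).symm
      exact ⟨t', ht'⟩

/-- A decreasing step is connected, by smaller terms, to a reduct. -/
theorem exists_reducts_of_step (H : S.IsSaturated R' I) (h : S.Step s t) (hgt : S.gt s t) :
    ∃ r, Reducts S R' s r ∧ S.ConnLt s t r := by
  rcases h with h | ⟨ρ, hρ, C, σ, h⟩
  · exact absurd (S.compat (.refl _) hgt h.symm) (S.irrefl _)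
  by_cases hC : C = .hole
  · subst hC
    rcases hρ with hρ | hρ
    · rcases h with ⟨rfl, rfl⟩ | ⟨rfl, rfl⟩
      · exact ⟨_, .inr ⟨hgt, ρ, .inl hρ, σ, .refl _, .refl _⟩, .refl _⟩
      · exact ⟨_, .inr ⟨hgt, ρ.swap, .inr (H.swap_mem hρ), σ, .refl _, .refl _⟩, .refl _⟩
    · rcases h with ⟨rfl, rfl⟩ | ⟨rfl, rfl⟩
      · rcases H.covered_init.traced _ _ ⟨ρ, H.Rd_subset hρ, σ, .refl _, .refl _⟩ hgt with
          ⟨t', h1, h2, h3⟩ | ⟨r, h1, h2⟩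
        · exact ⟨t', .inr ⟨gt_of_gt_of_le hgt h1, h2.mono Set.subset_union_left⟩, h3⟩
        · exact ⟨r, .inl h1, h2⟩
      · exact absurd (S.trans hgt (S.decreasing ρ hρ σ)) (S.irrefl _)
  · have key : ∀ {a b : L.Term V}, S.Step a b → S.gt (C.fill a) (C.fill b) →
        ∃ r, Reducts S R' (C.fill a) r ∧ S.ConnLt (C.fill a) (C.fill b) r := by
      intro a b hab hgt
      have hgt' := gt_of_fill_gt_fill hgt
      exact ⟨_, .inl (below_fill hC hgt' (.step (.refl _) (.of_gt hgt') hab)), .refl _⟩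
    rcases h with ⟨rfl, rfl⟩ | ⟨rfl, rfl⟩
    · exact key (.inst hρ σ) hgt
    · exact key (Step.inst hρ σ).symm hgt

/-- The first decrease in a proof that never exceeds its first term. -/
theorem exists_first_decrease (h : S.ConnLe s s t) (hgt : S.gt s t) :
    ∃ a b, EqMod S.Ed s a ∧ S.Step a b ∧ S.gt a b := by
  have key : EqMod S.Ed s t ∨ ∃ a b, EqMod S.Ed s a ∧ S.Step a b ∧ S.gt a b := by
    clear hgt
    induction h with
    | refl => exact .inl (.refl _)
    | @tail b c _ hbc ih =>
      rcases ih with ih | ih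
      · rcases hbc.2.1 with hc | hc
        · exact .inr ⟨b, c, ih, hbc.2.2, S.compat ih.symm hc (.refl _)⟩
        · exact .inl hc
      · exact .inr ih
  refine key.resolve_left fun h => ?_
  exact S.irrefl s (S.compat (.refl s) hgt h.symm)

/-- Every reducible term with irreducible immediate subterms is reduced at the root by a rule of `R`
to an irreducible term. -/
theorem reduced [Infinite X] [Nonempty V] (H : S.IsSaturated R' I) (s : L.Term V) :
    Reduced S s := by
  refine S.wf.induction (C := Reduced S) s fun s ih hred hs => ?_
  obtain ⟨t, hgt, hc⟩ := hred
  obtain ⟨a, b, ha, hab, hgt'⟩ := exists_first_decrease hc hgt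
  obtain ⟨r, hr, -⟩ := H.exists_reducts_of_step hab hgt'
  obtain ⟨q, hq⟩ := (H.exists_reducts_of_eqMod ih ha (.refl _)).2 ⟨r, hr⟩
  obtain ⟨h1, h2⟩ := hq.of_subNormal hs
  exact H.exists_inst_of_inst ih hs h2 h1

end IsSaturated
end GroundSystem

namespace GroundSystem

variable {S : GroundSystem L X V} {a b c s t : L.Term V}

/-! ### Saturated systems: uniqueness of normal forms -/

/-- `t` is a normal form of `s`, reached without exceeding `s`. -/
structure IsNormalForm (S : GroundSystem L X V) (s t : L.Term V) : Prop where
  not_red : ¬ S.Red t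
  le : S.Le t s
  connLe : S.ConnLe s s t

theorem exists_isNormalForm (s : L.Term V) : ∃ t, S.IsNormalForm s t := by
  obtain ⟨m, ⟨h1, h2⟩, hmin⟩ := S.wf.has_min {t | S.Le t s ∧ S.ConnLe s s t} ⟨s, .refl _, .refl _⟩
  refine ⟨m, fun ⟨t, ht, hc⟩ => ?_, h1, h2⟩
  exact hmin t ⟨.trans (.of_gt ht) h1, h2.trans (hc.mono h1)⟩ ht

theorem isNormalForm_self (h : ¬ S.Red s) : S.IsNormalForm s s := ⟨h, .refl _, .refl _⟩

theorem IsNormalForm.of_connLe (h : S.IsNormalForm b t) (hba : S.Le b a) (hc : S.ConnLe a a b) :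
    S.IsNormalForm a t :=
  ⟨h.not_red, h.le.trans hba, hc.trans (h.connLe.mono hba)⟩

/-- Normal forms of `s` are unique modulo `Ed`. -/
def Unique (S : GroundSystem L X V) (s : L.Term V) : Prop :=
  ∀ t t', S.IsNormalForm s t → S.IsNormalForm s t' → EqMod S.Ed t t'

/-- The larger of the two ends of a bounded proof reaches the normal form of the other one. -/
theorem eqMod_of_step {v w : L.Term V} (ha : Unique S a) (hb : Unique S b)
    (h : S.Conn (fun t => S.Le t a ∨ S.Le t b) a b) (hv : S.IsNormalForm a v)
    (hw : S.IsNormalForm b w) : EqMod S.Ed v w := by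
  rcases le_total (S := S) b a with hle | hle
  · exact ha v w hv (hw.of_connLe hle (h.connLe_of_le hle))
  · exact hb v w (hv.of_connLe hle ((h.symm.mono fun _ h => h.symm).connLe_of_le hle)) hw

theorem eqMod_of_connLt (ih : ∀ t, S.gt s t → Unique S t) (ha : S.gt s a) (h : S.ConnLt s a b) :
    ∀ v w, S.IsNormalForm a v → S.IsNormalForm b w → EqMod S.Ed v w := by
  induction h with
  | refl => exact ih a ha
  | @tail b c _ hbc ih' =>
    intro v w hv hw
    obtain ⟨v', hv'⟩ := exists_isNormalForm (S := S) b
    exact (ih' v v' hv hv').trans (eqMod_of_step (ih b hbc.1) (ih c hbc.2.1)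
      (.step (.inl (.refl _)) (.inr (.refl _)) hbc.2.2) hv' hw)

theorem connLt_of_below_of_below (ih : ∀ t, S.gt s t → Unique S t) (ha : S.Below s a)
    (hb : S.Below s b) : S.ConnLt s a b := by
  have hsa := ha.gt
  have hsb := hb.gt
  obtain ⟨n, f, ss, i, p, rfl, hp, hpc, rfl⟩ := ha
  obtain ⟨n', f', ss', j, p', heq, hp', hpc', rfl⟩ := hb
  cases heq
  by_cases hij : i = j
  · subst hij
    obtain ⟨v, hv⟩ := exists_isNormalForm (S := S) p
    obtain ⟨v', hv'⟩ := exists_isNormalForm (S := S) p'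
    have hvv' := ih _ (func_gt f ss i) v v' (hv.of_connLe (.of_gt hp) hpc)
      (hv'.of_connLe (.of_gt hp') hpc')
    have hpp' : S.ConnLt (ss i) p p' := (hv.connLe.connLt hp).trans (.trans
      (.eqMod (gt_of_gt_of_le hp hv.le) (gt_of_gt_of_le hp' hv'.le) hvv')
      (hv'.connLe.connLt hp').symm)
    exact hpp'.fill (.func f i ss .hole) fun t ht => update_gt f ss i ht
  · have h1 : S.Below (Term.func f (Function.update ss i p))
        (Term.func f (Function.update (Function.update ss i p) j p')) :=
      ⟨_, f, _, j, p', rfl, by simpa [Ne.symm hij] using hp', by simpa [Ne.symm hij] using hpc',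
        rfl⟩
    have h2 : S.Below (Term.func f (Function.update ss j p'))
        (Term.func f (Function.update (Function.update ss j p') i p)) :=
      ⟨_, f, _, i, p, rfl, by simpa [hij] using hp, by simpa [hij] using hpc, rfl⟩
    rw [Function.update_comm hij] at h1
    exact (h1.connLe.connLt hsa).trans (h2.connLe.connLt hsb).symm

namespace IsSaturated

variable {R' I : Set (Rule L X)}

/-- A decreasing instance at the root of a term that is reducible below the root is connected, by
smaller terms, to the result of a reduction below the root. -/
theorem exists_below_of_inst [Infinite X] [Nonempty V] (H : S.IsSaturated R' I)
    (hs : ¬ S.SubNormal s) (h : S.Inst (S.R ∪ R') s t) (hgt : S.gt s t) :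
    ∃ r, S.Below s r ∧ S.ConnLt s t r := by
  classical
  rcases H.covered.traced s t h hgt with ⟨t', hle, hinst, hc⟩ | h
  swap
  · exact h
  have hgt' := gt_of_gt_of_le hgt hle
  suffices h : ∃ r, S.Below s r ∧ S.ConnLt s t' r by
    obtain ⟨r, hr, hr'⟩ := h
    exact ⟨r, hr, hc.trans hr'⟩
  obtain ⟨⟨l, r⟩, hρ, σ, hvar, h1, h2⟩ := H.exists_nonvar_of_inst hinst hgt'
  cases l with
  | var x => exact absurd rfl (hvar x)
  | func f ls =>
  cases h1 with
  | func _ ss _ hss =>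
  set l : L.Term X := Term.func f ls
  have hl : EqMod S.Ed (Term.func f ss) (l.subst σ) := .congr f _ _ hss
  have hls : S.Le (l.subst σ) (Term.func f ss) := .of_eqMod hl.symm
  have hgt₂ : S.gt (Term.func f ss) (r.subst σ) := S.compat (.refl _) hgt' h2
  -- It suffices to reduce `lσ` below the root.
  suffices h : ∃ q, S.Below (l.subst σ) q ∧ S.ConnLt (Term.func f ss) (r.subst σ) q by
    obtain ⟨q, hq, hq'⟩ := h
    obtain ⟨q', hq₂, hqq'⟩ := hq.congr fun i => (hss i).symm
    exact ⟨q', hq₂, .trans (.eqMod hgt' hgt₂ h2)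
      (hq'.trans (.eqMod (gt_of_le_of_gt hls hq.gt) hq₂.gt hqq'))⟩
  simp only [SubNormal, not_forall, not_not] at hs
  obtain ⟨i, hi⟩ := hs
  rcases (hi.congr (hss i)).locate with ⟨x, hx, p, hp, hpc⟩ | ⟨C, p, hp, hp', hpr, hps⟩
  · let τ := Function.update σ x p
    have hle : ∀ y, S.Le (τ y) (σ y) := by
      intro y
      by_cases hy : y = x
      · subst hy; simpa [τ] using .of_gt hp
      · simpa [τ, hy] using .refl _
    have hc : ∀ y, S.ConnLe (σ y) (σ y) (τ y) := by
      intro y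
      by_cases hy : y = x
      · subst hy; simpa [τ] using hpc
      · simpa [τ, hy] using Conn.refl _
    have hgtx : S.gt (σ x) (τ x) := by simpa [τ] using hp
    have hxl : x ∈ varSet l := by simpa [l] using ⟨i, hx⟩
    obtain ⟨q, hq, hq'⟩ := exists_below_subst hvar hxl hle hc hgtx
    obtain ⟨h3, h4⟩ := connLe_subst r hle hc
    refine ⟨q, hq, (h4.connLt hgt₂).trans (.trans ?_ (hq'.mono hls).symm)⟩
    exact ((covered_R.bounded _ hρ τ).connLt_of_gt
      (gt_of_le_of_gt hls (subst_gt hxl hle hc hgtx)) (gt_of_gt_of_le hgt₂ h3)).symm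
  · obtain ⟨q, hq, hq', -⟩ := H.reduced _ hpr hps
    have hl' : l = (Ctx.func f i ls C).fill p := by simp [l, Ctx.fill, ← hp]
    have hb := below_fill (C := (Ctx.func f i ls C).subst σ) (by simp [Ctx.subst]) hq
      (hq'.connLe covered_R hq)
    rw [← Ctx.subst_fill, ← hl'] at hb
    exact ⟨_, hb, (H.conn_of_overlap hρ hl' hp' hq').connLt_of_gt hgt₂ (gt_of_le_of_gt hls hb.gt)⟩

/-- Any two reducts of a term are connected by smaller terms. -/
theorem connLt_of_reducts [Infinite X] [Nonempty V] (H : S.IsSaturated R' I)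
    (ih : ∀ t, S.gt s t → Unique S t) (ha : Reducts S R' s a) (hb : Reducts S R' s b) :
    S.ConnLt s a b := by
  by_cases hs : S.SubNormal s
  -- Both reducts come from rules of `R` applied at the root, which overlap there.
  · have key : ∀ {t}, Reducts S R' s t → ∃ t', S.gt s t' ∧ S.Inst S.R s t' ∧ S.ConnLt s t t' := by
      intro t ht
      obtain ⟨h1, h2⟩ := ht.of_subNormal hs
      rcases H.covered.traced s t h2 h1 with ⟨t', h3, h4, h5⟩ | ⟨r, hr, -⟩
      · exact ⟨t', gt_of_gt_of_le h1 h3, h4, h5⟩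
      · exact absurd hs hr.not_subNormal
    obtain ⟨a', ha', hai, hac⟩ := key ha
    obtain ⟨b', hb', hbi, hbc⟩ := key hb
    obtain ⟨ρ, hρ, σ, hvar, h1, h2⟩ := H.exists_nonvar_of_inst hai ha'
    have h3 := H.conn_of_overlap (C := .hole) hρ rfl hvar (hbi.congr h1 (.refl _))
    exact hac.trans (((h3.congr_bounds h2.symm (.refl b')).connLt_of_gt ha' hb').trans hbc.symm)
  · have key : ∀ {t}, Reducts S R' s t → ∃ r, S.Below s r ∧ S.ConnLt s t r := by
      rintro t (ht | ⟨h1, h2⟩)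
      · exact ⟨t, ht, .refl _⟩
      · exact H.exists_below_of_inst hs h2 h1
    obtain ⟨a', ha', hac⟩ := key ha
    obtain ⟨b', hb', hbc⟩ := key hb
    exact hac.trans ((connLt_of_below_of_below ih ha' hb').trans hbc.symm)

/-- Reducts of terms that are equal modulo `Ed` are connected by smaller terms. -/
theorem connLt_of_reducts_of_eqMod [Infinite X] [Nonempty V] (H : S.IsSaturated R' I)
    (ih : ∀ t, S.gt c t → Unique S t) (h : EqMod S.Ed a b) : EqMod S.Ed c a →
    ∀ {s t}, Reducts S R' a s → Reducts S R' b t → S.ConnLt c s t := by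
  have key : ∀ {a}, EqMod S.Ed c a → ∀ {s t}, Reducts S R' a s → Reducts S R' a t →
      S.ConnLt c s t := fun hc _ _ hs ht => (H.connLt_of_reducts
    (fun t h => ih t (S.compat hc h (.refl _))) hs ht).mono (.of_eqMod hc.symm)
  induction h with
  | refl => exact key
  | symm h ih' => exact fun hc _ _ hs ht => (ih' (hc.trans h.symm) ht hs).symm
  | trans h _ ih₁ ih₂ =>
    intro hc s t hs ht
    obtain ⟨r, hr⟩ := (H.exists_reducts_of_eqMod (fun t _ => H.reduced t) h hc).1 ⟨s, hs⟩
    exact (ih₁ hc hs hr).trans (ih₂ (hc.trans h) hr ht)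
  | @inst ρ h σ =>
    intro hc s t hs ht
    obtain ⟨s', t', hs', ht', hc'⟩ := H.exists_reducts_of_equation (g := ρ.1) (d := ρ.2) (.inl h)
        (fun t _ => H.reduced t) ⟨s, hs⟩
    exact (key hc hs hs').trans (.trans (hc'.mono (.of_eqMod hc.symm))
      (key (hc.trans (.inst h σ)) ht' ht))
  | congr f ts us h _ =>
    intro hc s t hs ht
    obtain ⟨s', hs', he⟩ := hs.congr h
    have hc' := hc.trans (.congr f _ _ h)
    exact .trans (.eqMod (S.compat hc hs.gt (.refl _)) (S.compat hc' hs'.gt (.refl _)) he)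
      (key hc' hs' ht)

/-- Normal forms are unique: by induction on the order, all proofs that leave the class of `s`
modulo `Ed` downwards lead to terms connected to a fixed reduct of `s` by smaller terms. -/
theorem unique [Infinite X] [Nonempty V] (H : S.IsSaturated R' I) (s : L.Term V) :
    Unique S s := by
  refine S.wf.induction (C := Unique S) s fun s ih v w hv hw => ?_
  by_cases hred : S.Red s
  · obtain ⟨a, b, ha, hab, hgt⟩ : ∃ a b, EqMod S.Ed s a ∧ S.Step a b ∧ S.gt a b := by
      obtain ⟨t, hgt, hc⟩ := hred
      exact exists_first_decrease hc hgt
    obtain ⟨q, hq, -⟩ := H.exists_reducts_of_step hab hgt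
    have key : ∀ t, S.ConnLe s s t → EqMod S.Ed s t ∨ S.gt s t ∧ S.ConnLt s q t := by
      intro t ht
      induction ht with
      | refl => exact .inl (.refl _)
      | @tail b c _ hbc ih' =>
        rcases hbc.2.1 with hc | hc
        swap
        · exact .inl hc
        refine .inr ⟨hc, ?_⟩
        rcases ih' with hb | ⟨hb, hb'⟩
        · obtain ⟨r, hr, hr'⟩ := H.exists_reducts_of_step hbc.2.2 (S.compat hb.symm hc (.refl _))
          exact (H.connLt_of_reducts_of_eqMod ih (ha.symm.trans hb) ha hq hr).trans
            (hr'.mono (.of_eqMod hb.symm)).symm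
        · exact hb'.tail ⟨hb, hc, hbc.2.2⟩
    have key' : ∀ t, S.IsNormalForm s t → S.gt s t ∧ S.ConnLt s q t := fun t ht =>
      (key t ht.connLe).resolve_left fun h => ht.not_red (hred.congr h)
    obtain ⟨h1, h2⟩ := key' v hv
    obtain ⟨h3, h4⟩ := key' w hw
    exact eqMod_of_connLt ih h1 (h2.symm.trans h4) v w (isNormalForm_self hv.not_red)
      (isNormalForm_self hw.not_red)
  · have key : ∀ t, S.IsNormalForm s t → EqMod S.Ed s t := fun t ht =>
      ht.le.resolve_left fun h => hred ⟨t, h, ht.connLe⟩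
    exact (key v hv).symm.trans (key w hw)

/-- Terms that are equal in the theory of `I` and `Ed` have the same normal forms. -/
theorem eqMod_of_isNormalForm [Infinite X] [Nonempty V] (H : S.IsSaturated R' I)
    (h : EqMod (I ∪ S.Ed) s t) : ∀ v w, S.IsNormalForm s v → S.IsNormalForm t w →
    EqMod S.Ed v w := by
  induction h with
  | refl t => exact H.unique t
  | symm _ ih => exact fun v w hv hw => (ih w v hw hv).symm
  | @trans a b c _ _ ih₁ ih₂ =>
    intro v w hv hw
    obtain ⟨r, hr⟩ := exists_isNormalForm (S := S) b
    exact (ih₁ v r hv hr).trans (ih₂ r w hr hw)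
  | @inst ρ h σ =>
    intro v w hv hw
    refine eqMod_of_step (H.unique _) (H.unique _) ?_ hv hw
    rcases h with h | h
    · exact H.covered_init.bounded ρ h σ
    · exact .eqMod (.inl (.refl _)) (.inr (.refl _)) (.inst h σ)
  | congr f ts us _ ih =>
    intro v w hv hw
    choose vs hvs using fun i => exists_isNormalForm (S := S) (ts i)
    choose ws hws using fun i => exists_isNormalForm (S := S) (us i)
    obtain ⟨h1, h2⟩ := connLe_func f (fun i => (hvs i).le) fun i => (hvs i).connLe
    obtain ⟨h3, h4⟩ := connLe_func f (fun i => (hws i).le) fun i => (hws i).connLe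
    obtain ⟨v', hv'⟩ := exists_isNormalForm (S := S) (Term.func f vs)
    obtain ⟨w', hw'⟩ := exists_isNormalForm (S := S) (Term.func f ws)
    have hvw : EqMod S.Ed (Term.func f vs) (Term.func f ws) :=
      .congr f _ _ fun i => ih i _ _ (hvs i) (hws i)
    refine (H.unique _ v v' hv (hv'.of_connLe h1 h2)).trans (.trans ?_
      (H.unique _ w' w (hw'.of_connLe h3 h4) hw))
    exact eqMod_of_step (H.unique _) (H.unique _)
      (.eqMod (.inl (.refl _)) (.inr (.refl _)) hvw) hv' hw'

end IsSaturated
end GroundSystem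

variable {N : Type w'}

/-! ### Soundness of the procedure -/

/-- All rules of `Q` are valid in the theory `E`. -/
def Sound (E Q : Set (Rule L X)) : Prop := ∀ ρ ∈ Q, EqMod E ρ.1 ρ.2

theorem Sound.of_subset {E Q : Set (Rule L X)} (h : Q ⊆ E) : Sound E Q := fun ρ hρ => by
  simpa [subst_var] using EqMod.inst (h hρ) (Term.var (L := L))

theorem Sound.of_normStep {E Rd Ed Q Q' : Set (Rule L X)} (hRd : Rd ⊆ E) (hEd : Ed ⊆ E)
    (h : NormStep Rd Ed Q Q') (hQ : Sound E Q) : Sound E Q' := by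
  cases h with
  | normR K l r r' h =>
    rintro ρ (hρ | rfl)
    · exact hQ _ (.inl hρ)
    · exact (hQ (l, r) (.inr rfl)).trans (h.eqMod hRd hEd)
  | normL K f ls j l' r h =>
    have key : EqMod E (Term.func f (Function.update ls j l')) r := by
      refine .trans ?_ (hQ _ (.inr rfl))
      simpa using EqMod.update f j (ts := ls) (us := ls) (fun _ _ => .refl _)
        (h.eqMod hRd hEd).symm
    rintro ρ (hρ | rfl | rfl)
    · exact hQ _ (.inl hρ)
    · exact key
    · exact key.symm
  | eq => exact fun ρ hρ => hQ ρ (.inl hρ)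
  | sub => exact fun ρ hρ => hQ ρ (.inl hρ)

theorem Sound.of_norm {E Rd Ed Q Q' : Set (Rule L X)} (hRd : Rd ⊆ E) (hEd : Ed ⊆ E)
    (h : Norm Rd Ed Q Q') (hQ : Sound E Q) : Sound E Q' := by
  induction h with
  | refl => exact hQ
  | tail _ h ih => exact ih.of_normStep hRd hEd h

theorem Sound.of_overlapSet {E Ed O : Set (Rule L X)} (hEd : Ed ⊆ E) {ρ₁ ρ₂ : Rule L X}
    (h₁ : EqMod E ρ₁.1 ρ₁.2) (h₂ : EqMod E ρ₂.1 ρ₂.2) {C : Ctx L X} {s : L.Term X}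
    (hs : ρ₁.2 = C.fill s) (hO : IsOverlapSet Ed ρ₁ C s ρ₂ O) : Sound E O := by
  obtain ⟨π, -, U, hU, rfl⟩ := hO
  rintro _ ⟨θ, hθ, rfl⟩
  refine (h₁.subst θ).trans ?_
  rw [hs, Ctx.subst_fill]
  exact .fill _ (((hU.sound θ hθ).mono hEd).trans ((h₂.relabel π).subst θ))

theorem Sound.of_generated {E Ed R R' : Set (Rule L X)} (hEd : Ed ⊆ E)
    (h : IsGenerated Ed R R') (hR : Sound E R) : Sound E R' := by
  obtain ⟨ov, hov, rfl⟩ := h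
  rintro ρ ((⟨ρ₁, h₁, ρ₂, h₂, C, s, hp, hρ⟩ | ⟨ρ₁, h₁, ρ₂, h₂, C, s, hp, hρ⟩) | ⟨ρ', h, rfl⟩)
  · have := Sound.of_overlapSet (ρ₁ := ρ₁.swap) hEd (hR _ h₁).symm (hR _ h₂) hp.1
      (hov ρ₁.swap C s ρ₂ hp)
    rcases hρ with hρ | hρ
    · exact this _ hρ
    · exact (this _ hρ).symm
  · refine Sound.of_overlapSet (ρ₁ := ρ₁) hEd ?_ (hR _ h₂) hp.1 (hov ρ₁ C s ρ₂ hp) ρ hρ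
    rcases h₁ with (h₁ | h₁) | ⟨ρ', h₁, rfl⟩
    · exact hR _ h₁
    · exact Sound.of_subset hEd _ h₁
    · exact (Sound.of_subset hEd _ h₁).symm
  · exact (hR _ h).symm

theorem Sound.of_reachable {E E' Rd Ed R : Set (Rule L X)} (hE' : E' ⊆ E) (hRd : Rd ⊆ E)
    (hEd : Ed ⊆ E) (h : Reachable E' Rd Ed R) : Sound E R := by
  induction h with
  | init h =>
    refine .of_norm hRd hEd h ?_
    rintro ρ ((hρ | hρ) | ⟨ρ', hρ, rfl⟩)
    · exact Sound.of_subset hRd _ hρ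
    · exact Sound.of_subset hE' _ hρ
    · exact (Sound.of_subset hE' _ hρ).symm
  | loop _ hg h ih =>
    refine .of_norm hRd hEd h ?_
    rintro ρ (hρ | hρ)
    · exact ih _ hρ
    · exact ih.of_generated hEd hg _ hρ

theorem Sound.eqMod {E Q : Set (Rule L X)} (h : Sound E Q) {ρ : Rule L X} (hρ : ρ ∈ Q)
    {V : Type*} (σ : X → L.Term V) : EqMod E (ρ.1.subst σ) (ρ.2.subst σ) := (h ρ hρ).subst σ

theorem GroundSystem.Conn.eqModOfSound {S : GroundSystem L X N} {E : Set (Rule L X)}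
    (hR : Sound E S.R) (hRd : S.Rd ⊆ E) (hEd : S.Ed ⊆ E) {P : L.Term N → Prop} {s t : L.Term N}
    (h : S.Conn P s t) : EqMod E s t := by
  induction h with
  | refl => exact .refl _
  | tail _ h ih =>
    refine ih.trans ?_
    rcases h.2.2 with h | ⟨ρ, hρ, C, σ, h⟩
    · exact h.mono hEd
    · have hρ' : EqMod E (ρ.1.subst σ) (ρ.2.subst σ) :=
        hρ.elim (fun hρ => hR.eqMod hρ σ) fun hρ => .inst (hRd hρ) σ
      rcases h with ⟨rfl, rfl⟩ | ⟨rfl, rfl⟩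
      · exact hρ'.fill C
      · exact hρ'.symm.fill C

/-! ### The ground system of an execution -/

theorem ground_relabel_inr (t : L.Term N) : Ground (X := X) (t.relabel Sum.inr) := by
  ext x; simp [termVars, varSet_relabel]

theorem EqMod.of_relabel_inr [Nonempty N] {E : Set (Rule L X)} {s t : L.Term N}
    (h : EqMod E (s.relabel (Sum.inr : N → X ⊕ N)) (t.relabel Sum.inr)) : EqMod E s t := by
  have := h.subst (Sum.elim (fun _ : X => Term.var (Classical.arbitrary N)) Term.var)
  simpa only [subst_relabel, Sum.elim_inr, subst_var] using this

theorem fill_relabel {V W : Type*} (C : Ctx L V) (t : L.Term V) (g : V → W) :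
    (C.fill t).relabel g = (C.subst fun x => Term.var (g x)).fill (t.relabel g) := by
  rw [relabel_eq_subst, Ctx.subst_fill, ← relabel_eq_subst]

theorem applySubst_embed (t : L.Term X) (σ : X → L.Term (X ⊕ N)) :
    applySubst (embed N t) σ = t.subst σ := by
  simp only [applySubst, embed, subst_relabel, Sum.elim_inl]

theorem finite_classes_of_injective {V W : Type*} {E : Set (Rule L X)} {g : V → W}
    (hg : Function.Injective g) (hfin : ∀ t : L.Term W, {s | EqMod E t s}.Finite) (t : L.Term V) :
    {s | EqMod E t s}.Finite :=
  ((hfin (t.relabel g)).preimage (relabel_injective hg).injOn).subset fun _ h => h.relabel g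

/-- The ground system given by a strong reduction order: the ground terms are the terms over `N`. -/
def groundSystem [Nonempty N] (Rd Ed R : Set (Rule L X))
    (gt : L.Term (X ⊕ N) → L.Term (X ⊕ N) → Prop) (hfin : FiniteClasses N Ed)
    (hgt : IsStrongReductionOrder gt Ed) (hcomp : CompatibleWith gt Rd) : GroundSystem L X N where
  gt s t := gt (s.relabel Sum.inr) (t.relabel Sum.inr)
  R := R
  Rd := Rd
  Ed := Ed
  irrefl _ := hgt.irrefl _
  trans := hgt.trans _ _ _
  wf := InvImage.wf (Term.relabel Sum.inr) hgt.wf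
  ctx C _ _ h := by
    rw [fill_relabel, fill_relabel]
    exact hgt.ctx _ _ _ h
  compat h h' h'' := hgt.compat _ _ _ _ (h.relabel _) h' (h''.relabel _)
  total s t := (hgt.total _ _ (ground_relabel_inr s) (ground_relabel_inr t)).imp_right
    (Or.imp_right EqMod.of_relabel_inr)
  finite := finite_classes_of_injective Sum.inr_injective hfin
  decreasing ρ hρ σ := by
    have := hgt.subst (fun x => (σ x).relabel Sum.inr) _ _ (hcomp ρ hρ)
    rwa [applySubst_embed, applySubst_embed, ← relabel_subst, ← relabel_subst] at this

theorem isSaturated_groundSystem [Infinite X] [Nonempty N] {E' Rd Ed R R' : Set (Rule L X)}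
    {gt : L.Term (X ⊕ N) → L.Term (X ⊕ N) → Prop} (hfin : FiniteClasses N Ed)
    (hgt : IsStrongReductionOrder gt Ed) (hcomp : CompatibleWith gt Rd)
    (hR : Reachable E' Rd Ed R) (hR' : IsGenerated Ed R R') (hnorm : Norm Rd Ed (R ∪ R') R)
    (hvars : ∀ ρ ∈ R, varSet ρ.2 ⊆ varSet ρ.1) :
    (groundSystem Rd Ed R gt hfin hgt hcomp).IsSaturated R' (initialRules E' Rd) where
  finite_classes := finite_classes_of_injective Sum.inl_injective hfin
  generated := hR'
  covered := GroundSystem.Covered.of_norm hnorm GroundSystem.covered_R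
  covered_init := GroundSystem.Covered.of_reachable
    (S := groundSystem Rd Ed R gt hfin hgt hcomp) hR GroundSystem.covered_R
  Rd_subset _ h := .inl (.inl h)
  vars := hvars
  not_new_var x r hr := by
    by_contra hx
    -- `R'` contains the inverse rule `r → x`, whose right-hand side is a new variable.
    have h₀ : GroundSystem.HasNewVar (R ∪ R') := by
      obtain ⟨ov, -, rfl⟩ := hR'
      exact ⟨r, x, .inr (.inr ⟨_, hr, rfl⟩), hx⟩
    have key : ∀ Q, Norm Rd Ed (R ∪ R') Q → GroundSystem.HasNewVar Q := by
      intro Q hQ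
      induction hQ with
      | refl => exact h₀
      | tail _ h ih =>
        exact GroundSystem.hasNewVar_of_normStep (S := groundSystem Rd Ed R gt hfin hgt hcomp)
          (finite_classes_of_injective Sum.inl_injective hfin) h ih
    obtain ⟨l, y, hl, hy⟩ := key R hnorm
    exact hy (hvars _ hl (by simp))

/-! ### Terms in normal form -/

theorem applySubst_name_eq_relabel (t : L.Term (X ⊕ N)) (σ : X → N) :
    (applySubst t fun x => name (σ x)) = (t.relabel (Sum.elim σ id)).relabel Sum.inr := by
  rw [applySubst, relabel_eq_subst, relabel_eq_subst, subst_subst]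
  congr 1
  ext1 (x | a) <;> rfl

/-- A renaming of the variables of a set of terms by fresh names can be undone. -/
theorem exists_subst_relabel_eq {M : Set (L.Term (X ⊕ N))} {σ : X → N}
    (hinj : Set.InjOn σ (⋃ t ∈ M, termVars t))
    (hfresh : ∀ x ∈ ⋃ t ∈ M, termVars t, ∀ b ∈ ⋃ t ∈ M, termNames t, σ x ≠ b) :
    ∃ β : N → L.Term (X ⊕ N), ∀ t ∈ M, (t.relabel (Sum.elim σ id)).subst β = t := by
  classical
  let β : N → L.Term (X ⊕ N) := fun a =>
    if h : ∃ x ∈ ⋃ t ∈ M, termVars t, σ x = a then Term.var (Sum.inl h.choose) else name a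
  refine ⟨β, fun t ht => ?_⟩
  rw [subst_relabel]
  conv_rhs => rw [← subst_var t]
  refine subst_congr fun y hy => ?_
  rcases y with x | a
  · have hx : x ∈ ⋃ t ∈ M, termVars t := Set.mem_biUnion ht hy
    have h : ∃ x' ∈ ⋃ t ∈ M, termVars t, σ x' = σ x := ⟨x, hx, rfl⟩
    have hc : h.choose = x := hinj h.choose_spec.1 hx h.choose_spec.2
    change β (σ x) = _
    rw [show β (σ x) = Term.var (Sum.inl h.choose) from dif_pos h, hc]
  · have ha : a ∈ ⋃ t ∈ M, termNames t := Set.mem_biUnion ht hy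
    refine dif_neg ?_
    rintro ⟨x, hx, hxa⟩
    exact hfresh x hx a ha hxa

/-- On ground terms, an equality `f(t₁, …, tₙ) = t` between terms such that `t₁, …, tₙ` and `t` are
irreducible is an instance of a rule of `R`, or holds modulo `Ed`. -/
theorem GroundSystem.IsSaturated.exists_rule [Infinite X] [Nonempty N] {S : GroundSystem L X N}
    {R' I : Set (Rule L X)} (H : S.IsSaturated R' I) {n : ℕ} (f : L.Functions n)
    {ts : Fin n → L.Term N} {t : L.Term N} (hts : ∀ i, ¬ S.Red (ts i)) (ht : ¬ S.Red t)
    (h : EqMod (I ∪ S.Ed) (Term.func f ts) t) :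
    EqMod S.Ed (Term.func f ts) t ∨ ∃ (ss : Fin n → L.Term X) (s : L.Term X) (τ : X → L.Term N),
      (Term.func f ss, s) ∈ S.R ∧ EqMod S.Ed t (s.subst τ) ∧
        ∀ i, EqMod S.Ed (ts i) ((ss i).subst τ) := by
  have ht' := isNormalForm_self ht
  by_cases hred : S.Red (Term.func f ts)
  · obtain ⟨v, hv, hv', hvn⟩ := H.reduced _ hred hts
    have hvt := H.eqMod_of_isNormalForm h v t
      ⟨hvn, .of_gt hv, hv'.connLe covered_R hv⟩ ht'
    obtain ⟨⟨l, r⟩, hρ, τ, hvar, h1, h2⟩ := H.exists_nonvar_of_inst hv' hv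
    cases l with
    | var x => exact absurd rfl (hvar x)
    | func g ss =>
      cases h1 with
      | func _ _ _ h1 => exact .inr ⟨ss, r, τ, hρ, hvt.symm.trans h2, h1⟩
  · exact .inl (H.eqMod_of_isNormalForm h _ t (isNormalForm_self hred) ht')

end RewTh

theorem mainTheorem1 {L : FirstOrder.Language} {X N : Type*} [Infinite X] [Infinite N]
    (E' Rd Ed R : Set (RewTh.Rule L X))
    (gt : L.Term (X ⊕ N) → L.Term (X ⊕ N) → Prop)
    (hfin : RewTh.FiniteClasses N Ed)
    (hgt : RewTh.IsStrongReductionOrder gt Ed)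
    (hcomp : RewTh.CompatibleWith gt Rd)
    (hrun : RewTh.GenExtendedReturns E' Rd Ed R)
    (hvars : ∀ ρ ∈ R, RewTh.varSet ρ.2 ⊆ RewTh.varSet ρ.1) :
    (RewTh.Tuple.mk gt R Rd Ed Ed).IsRewriteTheory ∧
      (RewTh.Tuple.mk gt R Rd Ed Ed).Mimics (E' ∪ Rd ∪ Ed) := by
  open RewTh FirstOrder.Language in
  obtain ⟨R₀, R', hreach, hgen, hnorm, xs, hxs, rfl⟩ := hrun
  have hE' : E' ⊆ E' ∪ Rd ∪ Ed := fun _ h => .inl (.inl h)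
  have hRd : Rd ⊆ E' ∪ Rd ∪ Ed := fun _ h => .inl (.inr h)
  have hEd : Ed ⊆ E' ∪ Rd ∪ Ed := fun _ h => .inr h
  have hsound : Sound (E' ∪ Rd ∪ Ed) R₀ := .of_reachable hE' hRd hEd hreach
  refine ⟨⟨subset_rfl, hgt, hcomp, ?_, hvars⟩, ⟨hEd, ?_, ?_, ?_⟩⟩
  · exact fun {n} f => ⟨xs n, hxs n, .inr ⟨n, f, rfl⟩⟩
  · rintro t t' ⟨ρ, hρ, C, s, σ, rfl, hs, rfl⟩
    exact .fill C ((hs.mono hEd).trans (.inst (hRd hρ) σ))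
  · rintro n f ts t (h | ⟨n', f', h⟩)
    · exact hsound _ h
    · cases h
      exact .refl _
  · intro n f ts t heq hnf
    obtain ⟨-, k, -, σ, hinj, hfresh, hmin⟩ := hnf
    let S := groundSystem Rd Ed R₀ gt hfin hgt hcomp
    have H : S.IsSaturated R' (initialRules E' Rd) := isSaturated_groundSystem hfin hgt hcomp
      hreach hgen hnorm fun ρ hρ => hvars ρ (.inl hρ)
    -- Terms in normal form are minimal in their class of `E`, hence irreducible.
    have hirr : ∀ s ∈ insert t (Set.range ts), ¬ S.Red (s.relabel (Sum.elim σ id)) := by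
      rintro s hs ⟨p, hp, hc⟩
      obtain ⟨m, ⟨-, -, hm⟩, hsm⟩ := hmin s hs
      rw [applySubst_name_eq_relabel] at hm hsm
      exact hm (p.relabel Sum.inr) (ground_relabel_inr p)
        ((GroundSystem.Conn.eqModOfSound hsound hRd hEd hc).relabel _)
        (hgt.compat _ _ _ _ hsm.symm hp (.refl _))
    obtain ⟨β, hβ⟩ := exists_subst_relabel_eq hinj fun x hx b hb hxb =>
      hgt.irrefl _ (hxb ▸ (hfresh x hx).2 b hb)
    have hβt := hβ t (.inl rfl)
    have hβts := fun i => hβ (ts i) (.inr ⟨i, rfl⟩)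
    have heq' : EqMod (initialRules E' Rd ∪ Ed)
        (Term.func f fun i => (ts i).relabel (Sum.elim σ id)) (t.relabel (Sum.elim σ id)) := by
      refine (heq.relabel (Sum.elim σ id)).mono ?_
      rintro ρ ((h | h) | h)
      · exact .inl (.inl (.inr h))
      · exact .inl (.inl (.inl h))
      · exact .inr h
    -- The names introduced by `σ` are replaced by variables again by means of `β`.
    rcases H.exists_rule f (fun i => hirr _ (.inr ⟨i, rfl⟩)) (hirr _ (.inl rfl)) heq' with
      h | ⟨ss, s, τ, hmem, h1, h2⟩
    · have h' : EqMod Ed (Term.func f ts) t := by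
        have := EqMod.subst (E := Ed) h β
        rw [hβt] at this
        simpa only [Term.subst, hβts] using this
      have hext : ∀ i, Function.extend (xs n) ts (fun _ => t) (xs n i) = ts i :=
        fun i => (hxs n).extend_apply _ _ i
      refine ⟨_, _, Function.extend (xs n) ts fun _ => t, .inr ⟨n, f, rfl⟩, ?_, fun i => ?_⟩
      · simpa only [Term.subst, hext] using h'.symm
      · simpa only [Term.subst, hext] using .refl _
    · refine ⟨ss, s, fun x => (τ x).subst β, .inl hmem, ?_, fun i => ?_⟩
      · simpa only [hβt, subst_subst] using EqMod.subst (E := Ed) h1 β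
      · simpa only [hβts, subst_subst] using EqMod.subst (E := Ed) (h2 i) β
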